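/- Let $0=T_0<T_1<T_2<\cdots$ be the random claim arrival times of a counting process on a probability space, where the value $T_i=\infty$ is allowed (the $i$-th claim never arrives; the times are strictly increasing as long as they are finite), and suppose that almost surely the number $N(t)=\max\{n\ge 0: T_n\le t\}$ of claims up to and including time $t$ is finite for all $t$. Let $X_1,X_2,\dots$ be real random variables (the claim sizes), $S(t)=\sum_{i=1}^{N(t)}X_i$ (with $S(t)=0$ if $N(t)=0$), and $\pi_{t,n}=\mathbf P[N(t)=n]$. Assume the following. (a) $N$ is an order statistic point process: for every $t>0$ there is a cdf $F_t$ with $F_t(x)=0$ for $x<0$ and $F_t(t)=1$ such that, for all $t>0$ and $n\ge 0$ with $\pi_{t,n}>0$, conditionally on $N(t)=n$ the times $T_1,\dots,T_n$ have the same joint distribution as the order statistics of $n$ i.i.d. random variables with cdf $F_t$. (b) For each $i\ge1$ the distribution of $X_i$ depends on the arrival process only via $T_{i-1},T_i$, that is, the conditional distribution of $X_i$ given $(T_k)_{k\ge0}$ equals almost surely the one given $(T_{i-1},T_i)$; and for all $1\le i<j$ the distribution of the product $X_iX_j$ depends, in the same sense, on the arrival process only via $T_{i-1},T_i,T_{j-1},T_j$.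 Fix $t>0$, and suppose that $F_t$ is absolutely continuous with density $f_t$, and that $\mathbf E[X_i^2\mathbf 1\{N(t)=n\}]<\infty$ for all $1\le i\le n$. Then, in $[0,\infty]$, $$\mathbf E[S^2(t)]=\sum_{n=1}^\infty \pi_{t,n}\,(A_{t,n}+2B_{t,n}),$$ where all the terms $\pi_{t,n}(A_{t,n}+2B_{t,n})$ are nonnegative, $$A_{t,n}=n\int_0^t \mathbf E[X_1^2|T_1=y]\,f_t(y)(1-F_t(y))^{n-1}\,dy+\sum_{i=2}^n\frac{n!}{(i-2)!(n-i)!}\int_0^t\int_0^y \mathbf E[X_i^2|T_{i-1}=x,T_i=y]\,f_t(x)f_t(y)F_t(x)^{i-2}(1-F_t(y))^{n-i}\,dx\,dy$$ and $$\begin{aligned}B_{t,n}&=n(n-1)\int_0^t\int_0^z\mathbf E[X_1X_2|T_1=y,T_2=z]\,f_t(y)f_t(z)(1-F_t(z))^{n-2}\,dy\,dz\\ &+\sum_{j=3}^n\frac{n!}{(j-3)!(n-j)!}\int_0^t\int_0^z\int_0^w\mathbf E[X_1X_j|T_1=y,T_{j-1}=w,T_j=z]\,f_t(y)f_t(w)f_t(z)(F_t(w)-F_t(y))^{j-3}(1-F_t(z))^{n-j}\,dy\,dw\,dz\\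 &+\sum_{i=2}^{n-1}\frac{n!}{(i-2)!(n-i-1)!}\int_0^t\int_0^z\int_0^w\mathbf E[X_iX_{i+1}|T_{i-1}=y,T_i=w,T_{i+1}=z]\,f_t(y)f_t(w)f_t(z)F_t(y)^{i-2}(1-F_t(z))^{n-i-1}\,dy\,dw\,dz\\ &+\sum_{i=2}^{n-2}\sum_{j=i+2}^n\frac{n!}{(i-2)!(j-i-2)!(n-j)!}\int_0^t\int_0^z\int_0^w\int_0^y\mathbf E[X_iX_j|T_{i-1}=x,T_i=y,T_{j-1}=w,T_j=z]\\ &\qquad\times f_t(x)f_t(y)f_t(w)f_t(z)F_t(x)^{i-2}(F_t(w)-F_t(y))^{j-i-2}(1-F_t(z))^{n-j}\,dx\,dy\,dw\,dz.\end{aligned}$$ For $n=1$ we read $B_{t,1}=0$. -/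

import Mathlib

open MeasureTheory ProbabilityTheory Set
open scoped ENNReal Nat

noncomputable section

/-- A sequence of claim arrival times with `T 0 = 0`. The value `∞` means that the claim never
arrives, so that a process with finitely many claims is included. Almost surely the times are
strictly increasing as long as they are finite, and every bounded interval contains only
finitely many of them. -/
structure IsArrivalSequence {Ω : Type*} [MeasurableSpace Ω] (μ : Measure Ω)
    (T : ℕ → Ω → ℝ≥0∞) : Prop where
  measurable : ∀ i, Measurable (T i)
  zero : ∀ᵐ ω ∂μ, T 0 ω = 0
  strictIncr : ∀ᵐ ω ∂μ, ∀ i, T i ω < T (i + 1) ω ∨ (T i ω = ∞ ∧ T (i + 1) ω = ∞)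
  nonexplosive : ∀ᵐ ω ∂μ, ∀ t : ℝ, ∃ n, ENNReal.ofReal t < T n ω

/-- The number `N(t)` of claims that arrive up to and including time `t`. -/
def claimCount {Ω : Type*} (T : ℕ → Ω → ℝ≥0∞) (t : ℝ) (ω : Ω) : ℕ :=
  sSup {n : ℕ | T n ω ≤ ENNReal.ofReal t}

/-- The aggregate claim size `S(t) = X_1 + ⋯ + X_{N(t)}`; the claims are numbered from `1`. -/
def aggregateClaim {Ω : Type*} (T : ℕ → Ω → ℝ≥0∞) (X : ℕ → Ω → ℝ) (t : ℝ) (ω : Ω) : ℝ :=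
  ∑ i ∈ Finset.Icc 1 (claimCount T t ω), X i ω

/-- `π_{t,n} = P[N(t) = n]`. -/
def countProb {Ω : Type*} [MeasurableSpace Ω] (μ : Measure Ω) (T : ℕ → Ω → ℝ≥0∞)
    (t : ℝ) (n : ℕ) : ℝ :=
  μ.real {ω | claimCount T t ω = n}

/-- The order statistics `x_{1:n} ≤ ⋯ ≤ x_{n:n}` of a tuple. -/
def orderStatistics {n : ℕ} (x : Fin n → ℝ) : Fin n → ℝ :=
  x ∘ Tuple.sort x

theorem measurable_orderStatistics {n : ℕ} :
    Measurable (orderStatistics : (Fin n → ℝ) → (Fin n → ℝ)) := by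
  classical
  refine measurable_pi_lambda _ fun k => measurable_of_Iic fun a => ?_
  have h : (fun x : Fin n → ℝ => orderStatistics x k) ⁻¹' Iic a
      = {x : Fin n → ℝ | (k : ℕ) < ∑ i, if x i ≤ a then 1 else 0} := by
    ext x
    have hm : Monotone (orderStatistics x) := Tuple.monotone_sort x
    have h1 := Tuple.lt_card_le_iff_apply_le_of_monotone (j := k) (a := a) hm
    have h2 : (∑ i, if orderStatistics x i ≤ a then 1 else 0)
        = ∑ i, if x i ≤ a then 1 else 0 :=
      Equiv.sum_comp (Tuple.sort x) (fun i => if x i ≤ a then 1 else 0)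
    rw [Finset.card_filter] at h1
    simp only [mem_preimage, mem_Iic, mem_ofPred_eq]
    rw [← h2]
    exact h1.symm
  rw [h]
  refine measurableSet_lt measurable_const (Finset.measurable_sum _ fun i _ => ?_)
  exact Measurable.ite (measurableSet_le (measurable_pi_apply i) measurable_const)
    measurable_const measurable_const

/-- `N(t)` is an order statistic point process with cdfs `F t` (cdfs of distributions on `[0,t]`):
for all `t > 0` and `n ≥ 0` with `P[N(t) = n] > 0`, the arrival times `T_1, …, T_n` have,
conditionally on `N(t) = n`, the joint distribution of the order statistics of `n` i.i.d. random
variables with cdf `F t`. -/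
structure IsOSPointProcess {Ω : Type*} [MeasurableSpace Ω] (μ : Measure Ω)
    (T : ℕ → Ω → ℝ≥0∞) (F : ℝ → StieltjesFunction ℝ) : Prop where
  arrival : IsArrivalSequence μ T
  cdf_of_neg : ∀ t, 0 < t → ∀ x, x < 0 → F t x = 0
  cdf_of_ge : ∀ t, 0 < t → ∀ x, t ≤ x → F t x = 1
  condLaw : ∀ t, 0 < t → ∀ n : ℕ, 0 < countProb μ T t n →
    (μ[|{ω | claimCount T t ω = n}]).map (fun ω (k : Fin n) => (T ((k : ℕ) + 1) ω).toReal)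
      = (Measure.pi fun _ : Fin n => (F t).measure).map orderStatistics

/-- `f` is a density of the cdf `F` (so that `F` is absolutely continuous). -/
structure IsDensityOf (f : ℝ → ℝ) (F : ℝ → ℝ) : Prop where
  integrable : Integrable f
  nonneg : ∀ᵐ x, 0 ≤ f x
  cdf_eq : ∀ x, F x = ∫ y in Iic x, f y

/-- The distribution of `Y` depends on the claim arrival process only via the times
`T (idx 0), …, T (idx (m-1))`: the conditional distribution of `Y` given the whole sequence of
arrival times is the conditional distribution of `Y` given these times. -/
def DependsOnlyVia {Ω : Type*} [MeasurableSpace Ω] (μ : Measure Ω) [IsFiniteMeasure μ]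
    (T : ℕ → Ω → ℝ≥0∞) (Y : Ω → ℝ) {m : ℕ} (idx : Fin m → ℕ) : Prop :=
  ∀ᵐ ω ∂μ, condDistrib Y (fun ω k => T k ω) μ (fun k => T k ω)
    = condDistrib Y (fun ω (k : Fin m) => T (idx k) ω) μ (fun k => T (idx k) ω)

/-- The conditional expectation `E[Y | T (idx 0) = s 0, …, T (idx (m-1)) = s (m-1)]`, as the
mean of the regular conditional distribution. -/
def condMean {Ω : Type*} [MeasurableSpace Ω] (μ : Measure Ω) [IsFiniteMeasure μ]
    (T : ℕ → Ω → ℝ≥0∞) (Y : Ω → ℝ) {m : ℕ} (idx : Fin m → ℕ) (s : Fin m → ℝ) : ℝ :=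
  ∫ u, u ∂(condDistrib Y (fun ω (k : Fin m) => T (idx k) ω) μ (fun k => ENNReal.ofReal (s k)))

/-- The quantity `A_{t,n}` built from the cdf `F` and the density `f` at time `t`. -/
def momentA {Ω : Type*} [MeasurableSpace Ω] (μ : Measure Ω) [IsFiniteMeasure μ]
    (T : ℕ → Ω → ℝ≥0∞) (X : ℕ → Ω → ℝ) (F f : ℝ → ℝ) (t : ℝ) (n : ℕ) : ℝ :=
  (n : ℝ) * (∫ y in (0 : ℝ)..t,
      condMean μ T (fun ω => X 1 ω ^ 2) ![1] ![y] * f y * (1 - F y) ^ (n - 1))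
  + ∑ i ∈ Finset.Icc 2 n, (n ! : ℝ) / (((i - 2)! : ℝ) * ((n - i)! : ℝ)) *
      ∫ y in (0 : ℝ)..t, ∫ x in (0 : ℝ)..y,
        condMean μ T (fun ω => X i ω ^ 2) ![i - 1, i] ![x, y]
          * f x * f y * F x ^ (i - 2) * (1 - F y) ^ (n - i)

/-- The quantity `B_{t,n}` built from the cdf `F` and the density `f` at time `t`. -/
def momentB {Ω : Type*} [MeasurableSpace Ω] (μ : Measure Ω) [IsFiniteMeasure μ]
    (T : ℕ → Ω → ℝ≥0∞) (X : ℕ → Ω → ℝ) (F f : ℝ → ℝ) (t : ℝ) (n : ℕ) : ℝ :=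
  (n : ℝ) * ((n : ℝ) - 1) * (∫ z in (0 : ℝ)..t, ∫ y in (0 : ℝ)..z,
      condMean μ T (fun ω => X 1 ω * X 2 ω) ![1, 2] ![y, z]
        * f y * f z * (1 - F z) ^ (n - 2))
  + (∑ j ∈ Finset.Icc 3 n, (n ! : ℝ) / (((j - 3)! : ℝ) * ((n - j)! : ℝ)) *
      ∫ z in (0 : ℝ)..t, ∫ w in (0 : ℝ)..z, ∫ y in (0 : ℝ)..w,
        condMean μ T (fun ω => X 1 ω * X j ω) ![1, j - 1, j] ![y, w, z]
          * f y * f w * f z * (F w - F y) ^ (j - 3) * (1 - F z) ^ (n - j))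
  + (∑ i ∈ Finset.Icc 2 (n - 1), (n ! : ℝ) / (((i - 2)! : ℝ) * ((n - i - 1)! : ℝ)) *
      ∫ z in (0 : ℝ)..t, ∫ w in (0 : ℝ)..z, ∫ y in (0 : ℝ)..w,
        condMean μ T (fun ω => X i ω * X (i + 1) ω) ![i - 1, i, i + 1] ![y, w, z]
          * f y * f w * f z * F y ^ (i - 2) * (1 - F z) ^ (n - i - 1))
  + ∑ i ∈ Finset.Icc 2 (n - 2), ∑ j ∈ Finset.Icc (i + 2) n,
      (n ! : ℝ) / (((i - 2)! : ℝ) * ((j - i - 2)! : ℝ) * ((n - j)! : ℝ)) *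
      ∫ z in (0 : ℝ)..t, ∫ w in (0 : ℝ)..z, ∫ y in (0 : ℝ)..w, ∫ x in (0 : ℝ)..y,
        condMean μ T (fun ω => X i ω * X j ω) ![i - 1, i, j - 1, j] ![x, y, w, z]
          * f x * f y * f w * f z
          * F x ^ (i - 2) * (F w - F y) ^ (j - i - 2) * (1 - F z) ^ (n - j)

end

/-! The events `N(t) = n` partition the space, so by nonnegativity E[S(t)²] is the sum over n of the
integral of (X_1 + ⋯ + X_n)² over `N(t) = n`. The square expands into terms Y = X_i² and Y = X_i
X_j, all integrable there, so it suffices to compute E[Y; N(t) = n] for each.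

Up to a null set the event is a function of the arrival times, so Y may be replaced by its
conditional mean given the two to four times it depends on (`setIntegral_eq_setIntegral_condMean`).
The order statistic property then turns these times into order statistics of an i.i.d. sample from
F_t.

Since F_t has no atoms, symmetry makes an integral over order statistics n! times one over
descending tuples (`lintegral_orderStatistics`). Integrating out r unselected points in a gap (a,b]
gives (F(b) - F(a))^r / r! (`descIntegral_selectSeq`), which yields the joint densities of the
selected order statistics. Tuples are descending because the target integrals have the largest time
outermost. This combinatorics is done for nonnegative integrands, and `gapIntegralReal_eq` passes to
signed ones. All terms of A and B are then instances of `setIntegral_eq_gapIntegralReal`. -/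

noncomputable section

/-! ### Iterated integrals over descending tuples -/

/-- Prepend a value to a sequence. -/
def consSeq (z : ℝ) (s : ℕ → ℝ) : ℕ → ℝ
  | 0 => z
  | m + 1 => s m

theorem measurable_consSeq : Measurable fun p : ℝ × (ℕ → ℝ) => consSeq p.1 p.2 := by
  refine measurable_pi_lambda _ fun m => ?_
  cases m with
  | zero => exact measurable_fst
  | succ m => exact (measurable_pi_apply m).comp measurable_snd

theorem Measurable.consSeq {α : Type*} [MeasurableSpace α] {z : α → ℝ} {s : α → ℕ → ℝ}
    (hz : Measurable z) (hs : Measurable s) : Measurable fun p => consSeq (z p) (s p) :=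
  measurable_consSeq.comp (hz.prodMk hs)

/-- The iterated integral `∫_{(0,b]} ∫_{(0,z₀]} ⋯ h(z₀, …, z_{n-1}, 0, …)` over antitone tuples. -/
def descIntegral (ν : Measure ℝ) : ℕ → ℝ → ((ℕ → ℝ) → ℝ≥0∞) → ℝ≥0∞
  | 0, _, h => h fun _ => 0
  | n + 1, b, h => ∫⁻ z in Ioc 0 b, descIntegral ν n z (fun s => h (consSeq z s)) ∂ν

theorem measurable_setLIntegral_Ioc {α : Type*} [MeasurableSpace α] (ν : Measure ℝ) [SFinite ν]
    {a b : α → ℝ} (ha : Measurable a) (hb : Measurable b) {g : α → ℝ → ℝ≥0∞}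
    (hg : Measurable fun p : α × ℝ => g p.1 p.2) :
    Measurable fun p => ∫⁻ z in Ioc (a p) (b p), g p z ∂ν := by
  have hS : MeasurableSet {p : α × ℝ | a p.1 < p.2 ∧ p.2 ≤ b p.1} :=
    (measurableSet_lt (ha.comp measurable_fst) measurable_snd).inter
      (measurableSet_le measurable_snd (hb.comp measurable_fst))
  have := (hg.indicator hS).lintegral_prod_right' (ν := ν)
  convert this using 2 with p
  rw [← lintegral_indicator measurableSet_Ioc]
  rfl

theorem measurable_descIntegral {α : Type*} [MeasurableSpace α] (ν : Measure ℝ) [SFinite ν]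
    (n : ℕ) {b : α → ℝ} (hb : Measurable b) {h : α → (ℕ → ℝ) → ℝ≥0∞}
    (hh : Measurable fun p : α × (ℕ → ℝ) => h p.1 p.2) :
    Measurable fun p => descIntegral ν n (b p) (h p) := by
  induction n generalizing α with
  | zero => exact hh.comp (measurable_id.prodMk measurable_const)
  | succ n ih =>
    refine measurable_setLIntegral_Ioc ν measurable_const hb ?_
    refine ih (α := α × ℝ) measurable_snd
      (h := fun q s => h q.1 (consSeq q.2 s)) ?_
    exact hh.comp ((measurable_fst.comp measurable_fst).prodMk
      ((measurable_snd.comp measurable_fst).consSeq measurable_snd))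

theorem setLIntegral_Ioc_swap (ν : Measure ℝ) [SFinite ν] [NullSingletonClass ν] (a b : ℝ)
    {g : ℝ → ℝ → ℝ≥0∞} (hg : Measurable fun p : ℝ × ℝ => g p.1 p.2) :
    ∫⁻ x in Ioc a b, ∫⁻ y in Ioc a x, g x y ∂ν ∂ν
      = ∫⁻ y in Ioc a b, ∫⁻ x in Ioc y b, g x y ∂ν ∂ν := by
  have hS : MeasurableSet {p : ℝ × ℝ | (a < p.1 ∧ p.1 ≤ b) ∧ a < p.2 ∧ p.2 ≤ p.1} := by
    refine MeasurableSet.inter ?_ ?_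
    · exact measurable_fst measurableSet_Ioc
    · exact (measurable_snd measurableSet_Ioi).inter (measurableSet_le measurable_snd measurable_fst)
  set ψ := {p : ℝ × ℝ | (a < p.1 ∧ p.1 ≤ b) ∧ a < p.2 ∧ p.2 ≤ p.1}.indicator
    (fun p : ℝ × ℝ => g p.1 p.2) with hψ
  have h1 : ∫⁻ x in Ioc a b, ∫⁻ y in Ioc a x, g x y ∂ν ∂ν = ∫⁻ x, ∫⁻ y, ψ (x, y) ∂ν ∂ν := by
    rw [← lintegral_indicator measurableSet_Ioc]
    refine lintegral_congr fun x => ?_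
    by_cases hx : x ∈ Ioc a b
    · rw [indicator_of_mem hx, ← lintegral_indicator measurableSet_Ioc]
      refine lintegral_congr fun y => ?_
      simp only [hψ, indicator, mem_Ioc, mem_ofPred_eq, hx.1, hx.2, true_and]
    · rw [indicator_of_notMem hx]
      symm
      refine (lintegral_congr fun y => ?_).trans lintegral_zero
      simp only [hψ, indicator, mem_ofPred_eq]
      rw [if_neg]
      exact fun h => hx h.1
  have h2 : ∫⁻ y in Ioc a b, ∫⁻ x in Ioc y b, g x y ∂ν ∂ν = ∫⁻ y, ∫⁻ x, ψ (x, y) ∂ν ∂ν := by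
    rw [← lintegral_indicator measurableSet_Ioc]
    refine lintegral_congr fun y => ?_
    by_cases hy : y ∈ Ioc a b
    -- The swapped region contains the diagonal `x = y`, which is null because `ν` has no atoms.
    · rw [indicator_of_mem hy, setLIntegral_congr Ioc_ae_eq_Icc,
        ← lintegral_indicator measurableSet_Icc]
      refine lintegral_congr fun x => ?_
      simp only [hψ, indicator, mem_Icc, mem_ofPred_eq]
      refine if_congr ⟨fun h => ⟨⟨hy.1.trans_le h.1, h.2⟩, hy.1, h.1⟩, fun h => ⟨h.2.2, h.1.2⟩⟩
        rfl rfl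
    · rw [indicator_of_notMem hy]
      symm
      refine (lintegral_congr fun x => ?_).trans lintegral_zero
      simp only [hψ, indicator, mem_ofPred_eq]
      rw [if_neg]
      exact fun h => hy ⟨h.2.1, h.2.2.trans h.1.2⟩
  rw [h1, h2]
  exact lintegral_lintegral_swap (hg.indicator hS).aemeasurable

/-- The weight `ν(a,b]^r / r!` of the antitone `r`-tuples in `(a,b]`. -/
def gapWeight (ν : Measure ℝ) (r : ℕ) (a b : ℝ) : ℝ≥0∞ :=
  ν (Ioc a b) ^ r * (r ! : ℝ≥0∞)⁻¹

theorem measurable_measure_Ioc {α : Type*} [MeasurableSpace α] (ν : Measure ℝ) [SFinite ν]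
    {a b : α → ℝ} (ha : Measurable a) (hb : Measurable b) :
    Measurable fun p => ν (Ioc (a p) (b p)) := by
  simpa using measurable_setLIntegral_Ioc ν ha hb (g := fun _ _ => 1) measurable_const

theorem measurable_gapWeight {α : Type*} [MeasurableSpace α] (ν : Measure ℝ) [SFinite ν] (r : ℕ)
    {a b : α → ℝ} (ha : Measurable a) (hb : Measurable b) :
    Measurable fun p => gapWeight ν r (a p) (b p) :=
  ((measurable_measure_Ioc ν ha hb).pow_const r).mul_const _

@[simp] theorem gapWeight_zero (ν : Measure ℝ) (a b : ℝ) : gapWeight ν 0 a b = 1 := by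
  simp [gapWeight]

theorem gapWeight_mul_measure (ν : Measure ℝ) (r : ℕ) (a b : ℝ) :
    gapWeight ν r a b * ν (Ioc a b) = (r + 1) * gapWeight ν (r + 1) a b := by
  have h : (r ! : ℝ≥0∞)⁻¹ = (r + 1) * ((r + 1)! : ℝ≥0∞)⁻¹ := by
    rw [Nat.factorial_succ, Nat.cast_mul, ENNReal.mul_inv (by simp) (by simp), ← mul_assoc,
      Nat.cast_add, Nat.cast_one, ENNReal.mul_inv_cancel (by simp) (by simp), one_mul]
  rw [gapWeight, gapWeight, h, pow_succ]
  ring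

/-- The rule ∫ F^r dF = F^(r+1)/(r+1), without differentiation. With `M` the integral of the weight
of order r+1, the swap gives M = ∫ w_r(a,y) ν(y,b], while (r+1)M = ∫ w_r(a,y) ν(a,y]. The two
measures add up to the constant ν(a,b], so (r+2)M = (r+2) w_{r+2}(a,b). -/
theorem setLIntegral_gapWeight (ν : Measure ℝ) [IsFiniteMeasure ν] [NullSingletonClass ν] (r : ℕ) (a b : ℝ) :
    ∫⁻ x in Ioc a b, gapWeight ν r a x ∂ν = gapWeight ν (r + 1) a b := by
  induction r generalizing b with
  | zero => simp [gapWeight]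
  | succ r ih =>
    have hm : Measurable fun y => gapWeight ν r a y :=
      measurable_gapWeight ν r measurable_const measurable_id
    have hm2 : Measurable fun y => gapWeight ν (r + 1) a y :=
      measurable_gapWeight ν (r + 1) measurable_const measurable_id
    set M := ∫⁻ x in Ioc a b, gapWeight ν (r + 1) a x ∂ν with hM
    have h1 : M = ∫⁻ y in Ioc a b, gapWeight ν r a y * ν (Ioc y b) ∂ν := by
      rw [hM]
      simp_rw [← ih]
      rw [setLIntegral_Ioc_swap ν a b (g := fun _ y => gapWeight ν r a y) (hm.comp measurable_snd)]
      simp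
    have h2 : M + (r + 1) * M = ν (Ioc a b) * gapWeight ν (r + 1) a b := by
      conv_lhs => lhs; rw [h1]
      rw [hM, ← lintegral_const_mul _ hm2, ← lintegral_add_right _ (hm2.const_mul _), ← ih,
        ← lintegral_const_mul _ hm]
      refine setLIntegral_congr_fun measurableSet_Ioc fun y hy => ?_
      rw [← gapWeight_mul_measure, ← mul_add, mul_comm, ← Ioc_union_Ioc_eq_Ioc hy.1.le hy.2,
        measure_union (by simp [disjoint_left]; grind) measurableSet_Ioc, add_comm (ν (Ioc y b))]
    rw [mul_comm (ν _), gapWeight_mul_measure] at h2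
    have h3 : ((r : ℝ≥0∞) + 2) * M = (r + 2) * gapWeight ν (r + 2) a b := by
      calc ((r : ℝ≥0∞) + 2) * M = M + (r + 1) * M := by ring
        _ = _ := by rw [h2]; push_cast; ring
    exact (ENNReal.mul_right_inj (by simp) (by simp)).1 h3

/-- The integrand ignores the r largest points, so these are integrated out over (z,b] with z the
next point; each one costs a swap and raises the order of the weight by one. -/
theorem descIntegral_shift (ν : Measure ℝ) [IsFiniteMeasure ν] [NullSingletonClass ν] (r n : ℕ) (b : ℝ)
    {h : (ℕ → ℝ) → ℝ≥0∞} (hh : Measurable h) :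
    descIntegral ν (r + (n + 1)) b (fun s => h fun m => s (r + m))
      = ∫⁻ z in Ioc 0 b, gapWeight ν r z b *
          descIntegral ν n z (fun s => h (consSeq z s)) ∂ν := by
  have hL : Measurable fun z => descIntegral ν n z (fun s => h (consSeq z s)) :=
    measurable_descIntegral ν n measurable_id (hh.comp measurable_consSeq)
  induction r generalizing b with
  | zero => simp [descIntegral]
  | succ r ih =>
    have : r + 1 + (n + 1) = r + (n + 1) + 1 := by ring
    rw [this, descIntegral]
    -- Dropping r+1 entries of `consSeq z s` drops `z` itself, so the inner integrand does not
    -- depend on `z`.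
    have h1 : ∀ z, descIntegral ν (r + (n + 1)) z
        (fun s => h fun m => consSeq z s (r + 1 + m))
        = descIntegral ν (r + (n + 1)) z (fun s => h fun m => s (r + m)) := by
      intro z
      congr 1
      funext s
      congr 1
      funext m
      rw [add_right_comm]; rfl
    simp_rw [h1, ih]
    rw [setLIntegral_Ioc_swap ν 0 b (g := fun x z => gapWeight ν r z x *
      descIntegral ν n z (fun s => h (consSeq z s)))]
    · refine lintegral_congr fun z => ?_
      rw [lintegral_mul_const _ (measurable_gapWeight ν r measurable_const measurable_id'),
        setLIntegral_gapWeight]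
    · exact (measurable_gapWeight ν r measurable_snd measurable_fst).mul (hL.comp measurable_snd)

theorem descIntegral_const (ν : Measure ℝ) [IsFiniteMeasure ν] [NullSingletonClass ν] (r : ℕ) (b : ℝ)
    (c : ℝ≥0∞) : descIntegral ν r b (fun _ => c) = gapWeight ν r 0 b * c := by
  induction r generalizing b with
  | zero => simp [descIntegral]
  | succ r ih =>
    simp_rw [descIntegral, ih]
    rw [lintegral_mul_const _ (measurable_gapWeight ν r measurable_const measurable_id'),
        setLIntegral_gapWeight]

/-- The terms with indices `r₀, r₀ + 1 + r₁, …` of a sequence, followed by zeros. -/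
def selectSeq : List ℕ → (ℕ → ℝ) → ℕ → ℝ
  | [], _ => fun _ => 0
  | r :: l, s => consSeq (s r) (selectSeq l fun m => s (r + (m + 1)))

theorem measurable_selectSeq (l : List ℕ) : Measurable (selectSeq l) := by
  induction l with
  | nil => exact measurable_const
  | cons r l ih =>
    exact (measurable_pi_apply r).consSeq
      (ih.comp (measurable_pi_lambda _ fun m => measurable_pi_apply _))

/-- The iterated integral of `h` over the entries selected by the gaps `l` from an antitone tuple
in `(0,b]`, the other entries being integrated out. -/
def gapIntegral (ν : Measure ℝ) (r : ℕ) : List ℕ → ℝ → ((ℕ → ℝ) → ℝ≥0∞) → ℝ≥0∞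
  | [], b, h => gapWeight ν r 0 b * h fun _ => 0
  | q :: l, b, h =>
    ∫⁻ z in Ioc 0 b, gapWeight ν q z b * gapIntegral ν r l z (fun s => h (consSeq z s)) ∂ν

theorem measurable_gapIntegral {α : Type*} [MeasurableSpace α] (ν : Measure ℝ) [SFinite ν]
    (r : ℕ) (l : List ℕ) {b : α → ℝ} (hb : Measurable b) {h : α → (ℕ → ℝ) → ℝ≥0∞}
    (hh : Measurable fun p : α × (ℕ → ℝ) => h p.1 p.2) :
    Measurable fun p => gapIntegral ν r l (b p) (h p) := by
  induction l generalizing α with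
  | nil =>
    exact (measurable_gapWeight ν r measurable_const hb).mul
      (hh.comp (measurable_id.prodMk measurable_const))
  | cons q l ih =>
    refine measurable_setLIntegral_Ioc ν measurable_const hb ?_
    refine (measurable_gapWeight ν q measurable_snd (hb.comp measurable_fst)).mul
      (ih (α := α × ℝ) measurable_snd (h := fun q s => h q.1 (consSeq q.2 s)) ?_)
    exact hh.comp ((measurable_fst.comp measurable_fst).prodMk
      ((measurable_snd.comp measurable_fst).consSeq measurable_snd))

/-- Each entry of `l` counts the points skipped just above a selected one, and `r` counts those
below the last one. `descIntegral_shift` handles a gap, `descIntegral_const` the bottom. -/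
theorem descIntegral_selectSeq (ν : Measure ℝ) [IsFiniteMeasure ν] [NullSingletonClass ν] (r : ℕ)
    (l : List ℕ) (b : ℝ) {h : (ℕ → ℝ) → ℝ≥0∞} (hh : Measurable h) :
    descIntegral ν (l.sum + l.length + r) b (fun s => h (selectSeq l s))
      = gapIntegral ν r l b h := by
  induction l generalizing b h with
  | nil => simpa [selectSeq, gapIntegral] using descIntegral_const ν r b _
  | cons q l ih =>
    have hn : (q :: l).sum + (q :: l).length + r = q + ((l.sum + l.length + r) + 1) := by
      simp; ring
    have hk : Measurable fun s : ℕ → ℝ => h (consSeq (s 0) (selectSeq l fun m => s (m + 1))) :=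
      hh.comp ((measurable_pi_apply 0).consSeq ((measurable_selectSeq l).comp
        (measurable_pi_lambda _ fun m => measurable_pi_apply _)))
    rw [hn, gapIntegral]
    refine (descIntegral_shift ν q _ b hk).trans (lintegral_congr fun z => ?_)
    congr 1
    exact ih z (hh.comp (measurable_const.consSeq measurable_id))

/-! ### Order statistics of an i.i.d. sample without atoms -/

/-- The entries of a tuple, followed by zeros. -/
def padSeq {n : ℕ} (x : Fin n → ℝ) : ℕ → ℝ := fun m => if h : m < n then x ⟨m, h⟩ else 0

theorem measurable_padSeq {n : ℕ} : Measurable (padSeq : (Fin n → ℝ) → ℕ → ℝ) := by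
  refine measurable_pi_lambda _ fun m => ?_
  unfold padSeq
  split_ifs
  · exact measurable_pi_apply _
  · exact measurable_const

theorem padSeq_cons {n : ℕ} (z : ℝ) (x : Fin n → ℝ) :
    padSeq (Fin.cons z x : Fin (n + 1) → ℝ) = consSeq z (padSeq x) := by
  funext m
  cases m with
  | zero => simp [padSeq, consSeq]
  | succ m =>
    by_cases h : m < n
    · have : (⟨m + 1, by omega⟩ : Fin (n + 1)) = Fin.succ ⟨m, h⟩ := rfl
      simp only [padSeq, consSeq, h, Nat.add_lt_add_iff_right, dif_pos, this, Fin.cons_succ]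
    · simp [padSeq, consSeq, h]

/-- The antitone `n`-tuples in `(0,b]`. -/
def antitoneTuples (n : ℕ) (b : ℝ) : Set (Fin n → ℝ) := {x | Antitone x ∧ ∀ i, x i ∈ Ioc 0 b}

theorem measurableSet_antitone (n : ℕ) : MeasurableSet {x : Fin n → ℝ | Antitone x} := by
  have : {x : Fin n → ℝ | Antitone x} = ⋂ i, ⋂ j, ⋂ _ : i ≤ j, {x | x j ≤ x i} := by
    ext x; simp [Antitone]
  rw [this]
  exact MeasurableSet.iInter fun i => MeasurableSet.iInter fun j => MeasurableSet.iInter fun _ =>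
    measurableSet_le (measurable_pi_apply j) (measurable_pi_apply i)

theorem measurableSet_antitoneTuples (n : ℕ) (b : ℝ) : MeasurableSet (antitoneTuples n b) := by
  have : antitoneTuples n b = {x | Antitone x} ∩ ⋂ i, {x | x i ∈ Ioc 0 b} := by
    ext x; simp [antitoneTuples]
  rw [this]
  exact (measurableSet_antitone n).inter
    (MeasurableSet.iInter fun i => measurable_pi_apply i measurableSet_Ioc)

theorem cons_mem_antitoneTuples {n : ℕ} {b z : ℝ} {x : Fin n → ℝ} :
    (Fin.cons z x : Fin (n + 1) → ℝ) ∈ antitoneTuples (n + 1) b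
      ↔ z ∈ Ioc 0 b ∧ x ∈ antitoneTuples n z := by
  constructor
  · rintro ⟨h1, h2⟩
    refine ⟨by simpa using h2 0, fun i j hij => ?_, fun i => ⟨?_, ?_⟩⟩
    · simpa using h1 (Fin.succ_le_succ_iff.2 hij)
    · simpa using (h2 i.succ).1
    · simpa using h1 (Fin.zero_le i.succ)
  · rintro ⟨hz, h1, h2⟩
    refine ⟨fun i j hij => ?_, fun i => ?_⟩
    · induction i using Fin.cases with
      | zero =>
        induction j using Fin.cases with
        | zero => simp
        | succ j => simpa using (h2 j).2
      | succ i =>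
        induction j using Fin.cases with
        | zero => exact absurd hij (by simp)
        | succ j => simpa using h1 (Fin.succ_le_succ_iff.1 hij)
    · induction i using Fin.cases with
      | zero => simpa using hz
      | succ i => simpa using ⟨(h2 i).1, (h2 i).2.trans hz.2⟩

/-- Tonelli in the first coordinate, which is the largest one and hence the upper bound for the
others. -/
theorem setLIntegral_antitoneTuples (ν : Measure ℝ) [SigmaFinite ν] (n : ℕ) (b : ℝ)
    {h : (ℕ → ℝ) → ℝ≥0∞} (hh : Measurable h) :
    ∫⁻ x in antitoneTuples n b, h (padSeq x) ∂Measure.pi (fun _ : Fin n => ν)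
      = descIntegral ν n b h := by
  induction n generalizing b h with
  | zero =>
    have h1 : antitoneTuples 0 b = univ :=
      eq_univ_of_forall fun x => ⟨fun i => i.elim0, fun i => i.elim0⟩
    have h2 : ∀ x : Fin 0 → ℝ, padSeq x = fun _ => 0 := fun x => by funext m; simp [padSeq]
    simp [h1, h2, descIntegral]
  | succ n ih =>
    have hmp := (measurePreserving_piFinSuccAbove (fun _ : Fin (n + 1) => ν) 0).symm
    have hS := measurableSet_antitoneTuples (n + 1) b
    have hm : Measurable fun x : Fin (n + 1) → ℝ => h (padSeq x) := hh.comp measurable_padSeq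
    rw [← lintegral_indicator hS, ← hmp.lintegral_comp (hm.indicator hS),
      lintegral_prod _ (by exact ((hm.indicator hS).comp hmp.measurable).aemeasurable), descIntegral,
      ← lintegral_indicator measurableSet_Ioc]
    refine lintegral_congr fun z => ?_
    have hc : ∀ x : Fin n → ℝ, (MeasurableEquiv.piFinSuccAbove (fun _ : Fin (n + 1) => ℝ) 0).symm
        (z, x) = (Fin.cons z x : Fin (n + 1) → ℝ) := fun x => by
      simp [MeasurableEquiv.piFinSuccAbove, Fin.insertNthEquiv]
    simp only [hc]
    by_cases hz : z ∈ Ioc 0 b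
    · rw [indicator_of_mem hz, ← ih z (h := fun s => h (consSeq z s)) (hh.comp (measurable_const.consSeq measurable_id')),
        ← lintegral_indicator (measurableSet_antitoneTuples n z)]
      refine lintegral_congr fun x => ?_
      by_cases hx : x ∈ antitoneTuples n z
      · rw [indicator_of_mem hx, indicator_of_mem (cons_mem_antitoneTuples.2 ⟨hz, hx⟩), padSeq_cons]
      · rw [indicator_of_notMem hx,
          indicator_of_notMem fun hx' => hx (cons_mem_antitoneTuples.1 hx').2]
    · rw [indicator_of_notMem hz]
      refine (lintegral_congr fun x => ?_).trans lintegral_zero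
      exact indicator_of_notMem (fun hx => hz (cons_mem_antitoneTuples.1 hx).1) _

theorem ae_injective_pi (ν : Measure ℝ) [SigmaFinite ν] [NullSingletonClass ν] (n : ℕ) :
    ∀ᵐ x ∂Measure.pi (fun _ : Fin n => ν), Function.Injective x := by
  have h : ∀ i j : Fin n, i ≠ j → ∀ᵐ x ∂Measure.pi (fun _ : Fin n => ν), x i ≠ x j := by
    intro i j hij
    obtain ⟨n, rfl⟩ : ∃ m, n = m + 1 := Nat.exists_eq_succ_of_ne_zero (by have := i.2; omega)
    obtain ⟨k, rfl⟩ := Fin.exists_succAbove_eq hij.symm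
    have hmp := measurePreserving_piFinSuccAbove (fun _ : Fin (n + 1) => ν) i
    have hS : MeasurableSet {p : ℝ × (Fin n → ℝ) | p.1 ≠ p.2 k} := by
      have hk : Measurable fun p : ℝ × (Fin n → ℝ) => p.2 k :=
        (measurable_pi_apply k).comp measurable_snd
      exact (measurableSet_eq_fun measurable_fst hk).compl
    -- With the other coordinates fixed, a tie confines coordinate `i` to a single point, which is
    -- null.
    have h1 : ∀ᵐ p ∂ν.prod (Measure.pi fun _ : Fin n => ν), p.1 ≠ p.2 k := by
      rw [Measure.ae_prod_iff_ae_ae hS, Measure.ae_ae_comm hS]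
      refine Filter.Eventually.of_forall fun y => ?_
      rw [ae_iff]
      simp
    exact hmp.quasiMeasurePreserving.ae h1
  have h' : ∀ᵐ x ∂Measure.pi (fun _ : Fin n => ν), ∀ i j : Fin n, i ≠ j → x i ≠ x j := by
    rw [ae_all_iff]; intro i
    rw [ae_all_iff]; intro j
    by_cases hij : i = j
    · simp [hij]
    · filter_upwards [h i j hij] with x hx using fun _ => hx
  filter_upwards [h'] with x hx i j hij
  by_contra hne
  exact hx i j hne hij

theorem lintegral_pi_comp_perm (ν : Measure ℝ) [SigmaFinite ν] {n : ℕ} (σ : Equiv.Perm (Fin n))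
    {g : (Fin n → ℝ) → ℝ≥0∞} (hg : Measurable g) :
    ∫⁻ x, g (x ∘ σ) ∂Measure.pi (fun _ : Fin n => ν) = ∫⁻ x, g x ∂Measure.pi (fun _ => ν) := by
  have hmp := measurePreserving_piCongrLeft (α := fun _ : Fin n => ℝ) (fun _ : Fin n => ν) σ.symm
  rw [← hmp.lintegral_comp hg]
  refine lintegral_congr fun x => ?_
  congr 1
  funext i
  have := Equiv.piCongrLeft_apply_apply (fun _ : Fin n => ℝ) σ.symm x (σ i)
  rw [Equiv.symm_apply_apply] at this
  exact this.symm

/-- Without ties exactly one permutation puts `x` in descending order: the sorting permutation read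
backwards. -/
theorem sum_perm_indicator_antitone {n : ℕ} {x : Fin n → ℝ} (hx : Function.Injective x)
    (g : (Fin n → ℝ) → ℝ≥0∞) :
    ∑ σ : Equiv.Perm (Fin n), {y | Antitone y}.indicator g (x ∘ σ)
      = g (fun i => orderStatistics x i.rev) := by
  have key : Antitone fun i : Fin n => orderStatistics x i.rev := fun i j hij =>
    Tuple.monotone_sort x (Fin.rev_le_rev.2 hij)
  rw [Finset.sum_eq_single (Fin.revPerm.trans (Tuple.sort x))]
  · rw [indicator_of_mem]
    · rfl
    · exact key
  · intro σ _ hσ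
    refine indicator_of_notMem (fun h : Antitone (x ∘ σ) => hσ ?_) _
    have := Tuple.unique_antitone (σ := σ) (τ := Fin.revPerm.trans (Tuple.sort x)) h key
    exact Equiv.ext fun i => hx (congrFun this i)
  · simp

/-- The product measure is invariant under permutations, so the n! summands of
`sum_perm_indicator_antitone` have equal integrals; ties are null. -/
theorem lintegral_orderStatistics (ν : Measure ℝ) [SigmaFinite ν] [NullSingletonClass ν] {n : ℕ}
    {g : (Fin n → ℝ) → ℝ≥0∞} (hg : Measurable g) :
    ∫⁻ x, g (fun i => orderStatistics x i.rev) ∂Measure.pi (fun _ : Fin n => ν)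
      = n ! * ∫⁻ x in {x | Antitone x}, g x ∂Measure.pi (fun _ : Fin n => ν) := by
  have hg' := hg.indicator (measurableSet_antitone n)
  calc _ = ∫⁻ x, ∑ σ : Equiv.Perm (Fin n), {y | Antitone y}.indicator g (x ∘ σ)
        ∂Measure.pi (fun _ : Fin n => ν) := by
        refine lintegral_congr_ae ?_
        filter_upwards [ae_injective_pi ν n] with x hx
        exact (sum_perm_indicator_antitone hx g).symm
    _ = ∑ σ : Equiv.Perm (Fin n), ∫⁻ x, {y | Antitone y}.indicator g x
        ∂Measure.pi (fun _ : Fin n => ν) := by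
        rw [lintegral_finsetSum]
        · exact Finset.sum_congr rfl fun σ _ => lintegral_pi_comp_perm ν σ hg'
        · exact fun σ _ => hg'.comp (measurable_pi_lambda _ fun i => measurable_pi_apply _)
    _ = _ := by
        rw [Finset.sum_const, Finset.card_univ, Fintype.card_perm, Fintype.card_fin,
          nsmul_eq_mul, lintegral_indicator (measurableSet_antitone n)]

theorem lintegral_selectSeq_orderStatistics (ν : Measure ℝ) [IsFiniteMeasure ν]
    [NullSingletonClass ν] {t : ℝ} (hν : ∀ᵐ x ∂ν, x ∈ Ioc 0 t) (r : ℕ) (l : List ℕ) {n : ℕ}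
    (hn : l.sum + l.length + r = n) {h : (ℕ → ℝ) → ℝ≥0∞} (hh : Measurable h) :
    ∫⁻ x, h (selectSeq l (padSeq fun i => orderStatistics x i.rev))
        ∂Measure.pi (fun _ : Fin n => ν)
      = n ! * gapIntegral ν r l t h := by
  have hs : Measurable fun s => h (selectSeq l s) := hh.comp (measurable_selectSeq l)
  rw [lintegral_orderStatistics ν (g := fun x => h (selectSeq l (padSeq x)))
    (hs.comp measurable_padSeq), ← descIntegral_selectSeq ν r l t hh, hn,
    ← setLIntegral_antitoneTuples ν n t hs]
  congr 1
  refine setLIntegral_congr ?_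
  have h1 : ∀ᵐ x ∂Measure.pi (fun _ : Fin n => ν), ∀ i, x i ∈ Ioc 0 t := by
    rw [ae_all_iff]
    exact fun i => (Measure.quasiMeasurePreserving_eval (fun _ : Fin n => ν) i).ae hν
  filter_upwards [h1] with x hx
  exact propext ⟨fun h => ⟨h, hx⟩, fun h => h.1⟩

/-! ### Signed integrands and densities -/

/-- The signed counterpart of `gapIntegral`, written with a cdf `F` and a density `f`. -/
def gapIntegralReal (F f : ℝ → ℝ) (r : ℕ) : List ℕ → ℝ → ((ℕ → ℝ) → ℝ) → ℝ
  | [], b, h => F b ^ r / r ! * h fun _ => 0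
  | q :: l, b, h => ∫ z in (0 : ℝ)..b,
      f z * ((F b - F z) ^ q / q ! * gapIntegralReal F f r l z (fun s => h (consSeq z s)))

theorem gapIntegral_mono (ν : Measure ℝ) (r : ℕ) (l : List ℕ) (b : ℝ)
    {g h : (ℕ → ℝ) → ℝ≥0∞} (hgh : ∀ s, g s ≤ h s) :
    gapIntegral ν r l b g ≤ gapIntegral ν r l b h := by
  induction l generalizing b g h with
  | nil => exact mul_le_mul_right (hgh _) _
  | cons q l ih =>
    exact lintegral_mono fun z => mul_le_mul_right (ih z fun s => hgh _) _

theorem toReal_gapWeight (G : StieltjesFunction ℝ) (r : ℕ) {a b : ℝ} (hab : a ≤ b) :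
    (gapWeight G.measure r a b).toReal = (G b - G a) ^ r / r ! := by
  rw [gapWeight, ENNReal.toReal_mul, ENNReal.toReal_pow, ENNReal.toReal_inv, ENNReal.toReal_natCast,
    StieltjesFunction.measure_Ioc, ENNReal.toReal_ofReal (sub_nonneg.2 (G.mono hab)), div_eq_mul_inv]

theorem intervalIntegral_density_mul {ν : Measure ℝ} {f : ℝ → ℝ}
    (hν : ν = volume.withDensity fun x => ENNReal.ofReal (f x)) (hfm : AEMeasurable f)
    (hf0 : ∀ᵐ x, 0 ≤ f x) {b : ℝ} (hb : 0 ≤ b) (g : ℝ → ℝ) :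
    ∫ z in (0 : ℝ)..b, f z * g z = ∫ z in Ioc 0 b, g z ∂ν := by
  rw [intervalIntegral.integral_of_le hb, hν,
    setIntegral_withDensity_eq_setIntegral_toReal_smul₀ hfm.ennreal_ofReal.restrict
      (by simp) _ measurableSet_Ioc]
  refine integral_congr_ae (ae_restrict_of_ae ?_)
  filter_upwards [hf0] with x hx
  rw [ENNReal.toReal_ofReal hx, smul_eq_mul]

/-- Finiteness of the iterated integral of `‖h‖ₑ` makes the positive and negative parts finite at
almost every stage, so the difference can be taken level by level. -/
theorem gapIntegralReal_eq {G : StieltjesFunction ℝ} {f : ℝ → ℝ} [IsFiniteMeasure G.measure]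
    (hG : G.measure = volume.withDensity fun x => ENNReal.ofReal (f x)) (hfm : AEMeasurable f)
    (hf0 : ∀ᵐ x, 0 ≤ f x) (hG0 : G 0 = 0) (r : ℕ) (l : List ℕ) {b : ℝ} (hb : 0 ≤ b)
    {h : (ℕ → ℝ) → ℝ} (hh : Measurable h)
    (hfin : gapIntegral G.measure r l b (fun s => ‖h s‖ₑ) ≠ ∞) :
    gapIntegralReal G f r l b h
      = (gapIntegral G.measure r l b fun s => ENNReal.ofReal (h s)).toReal
        - (gapIntegral G.measure r l b fun s => ENNReal.ofReal (-h s)).toReal := by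
  induction l generalizing b h with
  | nil =>
    simp only [gapIntegralReal, gapIntegral, ENNReal.toReal_mul]
    rw [toReal_gapWeight G r hb, hG0, sub_zero, ← mul_sub, ENNReal.toReal_ofReal',
      ENNReal.toReal_ofReal', max_zero_sub_eq_self]
  | cons q l ih =>
    rw [gapIntegralReal, intervalIntegral_density_mul hG hfm hf0 hb]
    simp only [gapIntegral] at hfin ⊢
    have hm : ∀ k : (ℕ → ℝ) → ℝ≥0∞, Measurable k → Measurable fun z => gapWeight G.measure q z b *
        gapIntegral G.measure r l z (fun s => k (consSeq z s)) := fun k hk =>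
      (measurable_gapWeight _ q measurable_id' measurable_const).mul
        (measurable_gapIntegral _ r l measurable_id' (hk.comp measurable_consSeq))
    have hmp := hm _ hh.ennreal_ofReal
    have hmn := hm (fun s => ENNReal.ofReal (-h s)) hh.neg.ennreal_ofReal
    have hle1 : ∀ s, ENNReal.ofReal (h s) ≤ ‖h s‖ₑ := fun s => Real.ofReal_le_enorm _
    have hle2 : ∀ s, ENNReal.ofReal (-h s) ≤ ‖h s‖ₑ := fun s => by
      simpa using Real.ofReal_le_enorm (-h s)
    have hp := ne_top_of_le_ne_top hfin (lintegral_mono fun z => mul_le_mul_right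
      (gapIntegral_mono G.measure r l z (fun s => hle1 (consSeq z s))) (gapWeight G.measure q z b))
    have hn := ne_top_of_le_ne_top hfin (lintegral_mono fun z => mul_le_mul_right
      (gapIntegral_mono G.measure r l z (fun s => hle2 (consSeq z s))) (gapWeight G.measure q z b))
    have hae := ae_lt_top (hm _ hh.enorm) hfin
    rw [← integral_toReal hmp.aemeasurable (ae_lt_top hmp hp),
      ← integral_toReal hmn.aemeasurable (ae_lt_top hmn hn),
      ← integral_sub (integrable_toReal_of_lintegral_ne_top hmp.aemeasurable hp)
        (integrable_toReal_of_lintegral_ne_top hmn.aemeasurable hn)]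
    refine integral_congr_ae ?_
    filter_upwards [hae, ae_restrict_mem measurableSet_Ioc] with z hz hzb
    simp only [ENNReal.toReal_mul]
    rw [← mul_sub, toReal_gapWeight G q hzb.2]
    -- Where the weight vanishes the inner integral may be infinite, but both sides are then zero.
    -- Elsewhere a finite product forces a finite inner integral.
    by_cases hw : gapWeight G.measure q z b = 0
    · rw [← toReal_gapWeight G q hzb.2, hw]
      simp
    · rw [ih hzb.1.le (h := fun s => h (consSeq z s))
        (hh.comp (measurable_const.consSeq measurable_id'))]
      intro htop
      rw [htop, ENNReal.mul_top hw] at hz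
      exact lt_irrefl _ hz

theorem integral_selectSeq_orderStatistics {G : StieltjesFunction ℝ} {f : ℝ → ℝ}
    [IsFiniteMeasure G.measure]
    (hG : G.measure = volume.withDensity fun x => ENNReal.ofReal (f x)) (hfm : AEMeasurable f)
    (hf0 : ∀ᵐ x, 0 ≤ f x) (hG0 : G 0 = 0) {t : ℝ} (ht : 0 ≤ t)
    (hGt : ∀ᵐ x ∂G.measure, x ∈ Ioc 0 t) (r : ℕ) (l : List ℕ) {n : ℕ}
    (hn : l.sum + l.length + r = n) {h : (ℕ → ℝ) → ℝ} (hh : Measurable h)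
    (hint : Integrable (fun x => h (selectSeq l (padSeq fun i => orderStatistics x i.rev)))
      (Measure.pi fun _ : Fin n => G.measure)) :
    ∫ x, h (selectSeq l (padSeq fun i => orderStatistics x i.rev))
        ∂Measure.pi (fun _ : Fin n => G.measure)
      = n ! * gapIntegralReal G f r l t h := by
  have : NullSingletonClass G.measure := by rw [hG]; infer_instance
  -- As n! is nonzero, integrability under the product measure bounds the iterated integral.
  have hfin : gapIntegral G.measure r l t (fun s => ‖h s‖ₑ) ≠ ∞ := by
    intro htop
    have := hint.2
    rw [HasFiniteIntegral, lintegral_selectSeq_orderStatistics G.measure hGt r l hn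
      (h := fun s => ‖h s‖ₑ) hh.enorm, htop, ENNReal.mul_top
      (by exact_mod_cast n.factorial_ne_zero)] at this
    exact lt_irrefl _ this
  rw [integral_eq_lintegral_pos_part_sub_lintegral_neg_part hint,
    lintegral_selectSeq_orderStatistics G.measure hGt r l hn
      (h := fun s => ENNReal.ofReal (h s)) hh.ennreal_ofReal,
    lintegral_selectSeq_orderStatistics G.measure hGt r l hn
      (h := fun s => ENNReal.ofReal (-h s)) hh.neg.ennreal_ofReal,
    gapIntegralReal_eq hG hfm hf0 hG0 r l ht hh hfin]
  simp only [ENNReal.toReal_mul, ENNReal.toReal_natCast, mul_sub]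

/-! ### The measure of a cdf with a density -/

section Density

variable {G : StieltjesFunction ℝ} {f : ℝ → ℝ} {t : ℝ}

theorem stieltjes_measure_eq_withDensity (hneg : ∀ x < 0, G x = 0) (hf : IsDensityOf f G) :
    G.measure = volume.withDensity fun x => ENNReal.ofReal (f x) := by
  have hbot : Filter.Tendsto G Filter.atBot (nhds 0) :=
    tendsto_const_nhds.congr' ((Filter.eventually_lt_atBot 0).mono fun x hx => (hneg x hx).symm)
  have : IsFiniteMeasure (volume.withDensity fun x => ENNReal.ofReal (f x)) :=
    isFiniteMeasure_withDensity_ofReal hf.integrable.2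
  symm
  refine Measure.ext_of_Iic _ _ fun x => ?_
  rw [G.measure_Iic hbot, withDensity_apply _ measurableSet_Iic, sub_zero, hf.cdf_eq,
    ofReal_integral_eq_lintegral_ofReal hf.integrable.integrableOn (ae_restrict_of_ae hf.nonneg)]

/-- The cdf is known to vanish only left of 0; absolute continuity rules out a jump at 0. -/
theorem stieltjes_zero_eq_zero (hneg : ∀ x < 0, G x = 0) (hf : IsDensityOf f G) : G 0 = 0 := by
  have h1 : G.measure {0} = 0 := by
    rw [stieltjes_measure_eq_withDensity hneg hf]
    exact measure_singleton 0
  have h2 : Function.leftLim G 0 = 0 := by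
    refine leftLim_eq_of_tendsto ?_
    exact tendsto_const_nhds.congr' (eventually_mem_nhdsWithin.mono fun x hx => (hneg x hx).symm)
  rw [StieltjesFunction.measure_singleton, h2, ENNReal.ofReal_eq_zero, sub_zero] at h1
  refine le_antisymm h1 ?_
  exact (hneg (-1) (by norm_num)).symm.le.trans (G.mono (by norm_num))

theorem ae_stieltjes_measure_mem_Ioc (hneg : ∀ x < 0, G x = 0) (hge : ∀ x, t ≤ x → G x = 1)
    (hf : IsDensityOf f G) : ∀ᵐ x ∂G.measure, x ∈ Ioc 0 t := by
  have hbot : Filter.Tendsto G Filter.atBot (nhds 0) :=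
    tendsto_const_nhds.congr' ((Filter.eventually_lt_atBot 0).mono fun x hx => (hneg x hx).symm)
  have htop : Filter.Tendsto G Filter.atTop (nhds 1) :=
    tendsto_const_nhds.congr' ((Filter.eventually_ge_atTop t).mono fun x hx => (hge x hx).symm)
  have h1 : ∀ᵐ x ∂G.measure, x ∉ Iic 0 := by
    rw [← measure_eq_zero_iff_ae_notMem, G.measure_Iic hbot, stieltjes_zero_eq_zero hneg hf]
    simp
  have h2 : ∀ᵐ x ∂G.measure, x ∉ Ioi t := by
    rw [← measure_eq_zero_iff_ae_notMem, G.measure_Ioi htop, hge t le_rfl]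
    simp
  filter_upwards [h1, h2] with x hx1 hx2
  exact ⟨not_le.1 hx1, not_lt.1 hx2⟩

theorem isFiniteMeasure_stieltjes (hneg : ∀ x < 0, G x = 0) (hf : IsDensityOf f G) :
    IsFiniteMeasure G.measure := by
  rw [stieltjes_measure_eq_withDensity hneg hf]
  exact isFiniteMeasure_withDensity_ofReal hf.integrable.2

end Density

/-! ### Conditioning on the arrival times -/

/-- Removes redundant times from the conditioning: T_0 = 0, and T_i = T_{j-1} when j = i+1. If the
old times are a function `c` of the new ones, the old kernel composed with `c` is the conditional
law given the whole sequence and depends on the new times only, so by uniqueness it is the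
conditional law given these. -/
theorem DependsOnlyVia.ae_eq_of_refine {Ω : Type*} [MeasurableSpace Ω] {μ : Measure Ω}
    [IsFiniteMeasure μ] {T : ℕ → Ω → ℝ≥0∞} (hT : ∀ i, Measurable (T i)) {Y : Ω → ℝ}
    (hY : Measurable Y) {m m' : ℕ} {idx : Fin m → ℕ} {idx' : Fin m' → ℕ}
    (hdep : DependsOnlyVia μ T Y idx) {c : (Fin m' → ℝ≥0∞) → (Fin m → ℝ≥0∞)} (hc : Measurable c)
    (hcT : ∀ᵐ ω ∂μ, (fun k => T (idx k) ω) = c fun k => T (idx' k) ω) :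
    DependsOnlyVia μ T Y idx' := by
  set τ : Ω → ℕ → ℝ≥0∞ := fun ω k => T k ω with hτ
  set V : Ω → Fin m → ℝ≥0∞ := fun ω k => T (idx k) ω with hV
  set U : Ω → Fin m' → ℝ≥0∞ := fun ω k => T (idx' k) ω with hU
  have hτm : Measurable τ := measurable_pi_lambda _ hT
  have hUm : Measurable U := measurable_pi_lambda _ fun k => hT _
  set κ := condDistrib Y V μ
  have h1 : ∀ᵐ ω ∂μ, condDistrib Y τ μ (τ ω) = κ (c (U ω)) := by
    filter_upwards [hdep, hcT] with ω h2 h3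
    rw [← h3]
    exact h2
  have h4 : condDistrib Y U μ =ᵐ[μ.map U] κ.comap c hc := by
    refine condDistrib_ae_eq_of_measure_eq_compProd U hY.aemeasurable ?_
    refine Measure.ext_of_lintegral _ fun g hg => ?_
    have hψ : Measurable fun p : (ℕ → ℝ≥0∞) × ℝ => g (fun k => p.1 (idx' k), p.2) :=
      hg.comp ((measurable_pi_lambda _ fun k =>
        (measurable_pi_apply _).comp measurable_fst).prodMk measurable_snd)
    calc ∫⁻ p, g p ∂μ.map (fun ω => (U ω, Y ω)) = ∫⁻ ω, g (U ω, Y ω) ∂μ :=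
          lintegral_map hg (hUm.prodMk hY)
      _ = ∫⁻ p, g (fun k => p.1 (idx' k), p.2) ∂μ.map (fun ω => (τ ω, Y ω)) :=
          (lintegral_map hψ (hτm.prodMk hY)).symm
      _ = ∫⁻ ω, ∫⁻ y, g (U ω, y) ∂condDistrib Y τ μ (τ ω) ∂μ := by
          rw [← compProd_map_condDistrib hY.aemeasurable, Measure.lintegral_compProd hψ,
            lintegral_map _ hτm]
          exact hψ.lintegral_kernel_prod_right'
      _ = ∫⁻ ω, ∫⁻ y, g (U ω, y) ∂κ (c (U ω)) ∂μ := by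
          refine lintegral_congr_ae ?_
          filter_upwards [h1] with ω hω
          rw [hω]
      _ = _ := by
          rw [Measure.lintegral_compProd hg, lintegral_map _ hUm]
          · rfl
          · exact hg.lintegral_kernel_prod_right'
  filter_upwards [h1, ae_of_ae_map hUm.aemeasurable h4] with ω h2 h3
  rw [h2]
  exact h3.symm

theorem DependsOnlyVia.comp {Ω : Type*} [MeasurableSpace Ω] {μ : Measure Ω}
    [IsFiniteMeasure μ] {T : ℕ → Ω → ℝ≥0∞} (hT : ∀ i, Measurable (T i)) {Y : Ω → ℝ}
    (hY : Measurable Y) {m : ℕ} {idx : Fin m → ℕ} (hdep : DependsOnlyVia μ T Y idx)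
    {g : ℝ → ℝ} (hg : Measurable g) : DependsOnlyVia μ T (fun ω => g (Y ω)) idx := by
  have hτm : Measurable fun ω (k : ℕ) => T k ω := measurable_pi_lambda _ hT
  have hVm : Measurable fun ω (k : Fin m) => T (idx k) ω := measurable_pi_lambda _ fun k => hT _
  have h1 := condDistrib_comp (mβ := MeasurableSpace.pi) (μ := μ) (fun ω (k : ℕ) => T k ω) hY.aemeasurable hg
  have h2 := condDistrib_comp (mβ := MeasurableSpace.pi) (μ := μ) (fun ω (k : Fin m) => T (idx k) ω) hY.aemeasurable hg
  filter_upwards [hdep, ae_of_ae_map hτm.aemeasurable h1, ae_of_ae_map hVm.aemeasurable h2]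
    with ω h3 h4 h5
  refine h4.trans (Eq.trans ?_ h5.symm)
  rw [Kernel.map_apply _ hg, Kernel.map_apply _ hg, h3]

theorem measurable_condMean {Ω : Type*} [MeasurableSpace Ω] (μ : Measure Ω) [IsFiniteMeasure μ]
    (T : ℕ → Ω → ℝ≥0∞) (Y : Ω → ℝ) {m : ℕ} (idx : Fin m → ℕ) :
    Measurable (condMean μ T Y idx) := by
  have h : Measurable fun u : Fin m → ℝ≥0∞ =>
      ∫ y, y ∂condDistrib Y (fun ω (k : Fin m) => T (idx k) ω) μ u :=
    (StronglyMeasurable.integral_condDistrib (f := Prod.snd)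
      measurable_snd.stronglyMeasurable).measurable
  exact h.comp (measurable_pi_lambda _ fun k => (measurable_pi_apply k).ennreal_ofReal)

/-- `Y` is integrable only on the event, so the disintegration over the arrival sequence is applied
to `Y` times the indicator of `S`. Finite times on `S` are needed because `condMean` takes real
arguments. -/
theorem setIntegral_eq_setIntegral_condMean {Ω : Type*} [MeasurableSpace Ω] {μ : Measure Ω}
    [IsFiniteMeasure μ] {T : ℕ → Ω → ℝ≥0∞} (hT : ∀ i, Measurable (T i)) {Y : Ω → ℝ}
    (hY : Measurable Y) {m : ℕ} {idx : Fin m → ℕ} (hdep : DependsOnlyVia μ T Y idx)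
    {S : Set (ℕ → ℝ≥0∞)} (hS : MeasurableSet S)
    (hfin : ∀ s ∈ S, ∀ k, s (idx k) ≠ ∞)
    (hint : IntegrableOn Y ((fun ω k => T k ω) ⁻¹' S) μ) :
    IntegrableOn (fun ω => condMean μ T Y idx fun k => (T (idx k) ω).toReal)
        ((fun ω k => T k ω) ⁻¹' S) μ ∧
      ∫ ω in (fun ω k => T k ω) ⁻¹' S, Y ω ∂μ
        = ∫ ω in (fun ω k => T k ω) ⁻¹' S,
            condMean μ T Y idx (fun k => (T (idx k) ω).toReal) ∂μ := by
  set τ : Ω → ℕ → ℝ≥0∞ := fun ω k => T k ω with hτ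
  have hτm : Measurable τ := measurable_pi_lambda _ hT
  set g : (ℕ → ℝ≥0∞) × ℝ → ℝ := (Prod.fst ⁻¹' S).indicator Prod.snd with hg
  have hgm : Measurable g := measurable_snd.indicator (measurable_fst hS)
  have hE : MeasurableSet (τ ⁻¹' S) := hτm hS
  have hgY : (fun ω => g (τ ω, Y ω)) = (τ ⁻¹' S).indicator Y := rfl
  have hgint : Integrable g (μ.map fun ω => (τ ω, Y ω)) := by
    rw [integrable_map_measure hgm.aestronglyMeasurable (hτm.prodMk hY).aemeasurable]
    exact (integrable_indicator_iff hE).2 hint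
  have hgint' : Integrable g (μ.map τ ⊗ₘ condDistrib Y τ μ) := by
    rwa [compProd_map_condDistrib hY.aemeasurable]
  have hmean : ∀ᵐ ω ∂μ, ∫ y, g (τ ω, y) ∂condDistrib Y τ μ (τ ω)
      = (τ ⁻¹' S).indicator (fun ω => condMean μ T Y idx fun k => (T (idx k) ω).toReal) ω := by
    filter_upwards [hdep] with ω hω
    by_cases hωS : τ ω ∈ S
    · rw [indicator_of_mem (show ω ∈ τ ⁻¹' S from hωS), condMean]
      have : (fun k => ENNReal.ofReal (T (idx k) ω).toReal) = fun k => T (idx k) ω :=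
        funext fun k => ENNReal.ofReal_toReal (hfin _ hωS k)
      rw [this, ← hω]
      refine integral_congr_ae (Filter.Eventually.of_forall fun y => ?_)
      simp [hg, hωS]
    · rw [indicator_of_notMem (show ω ∉ τ ⁻¹' S from hωS)]
      simp [hg, hωS]
  have h1 : Integrable (fun ω => ∫ y, g (τ ω, y) ∂condDistrib Y τ μ (τ ω)) μ :=
    (hgint.integral_condDistrib_map hY.aemeasurable).comp_measurable hτm
  refine ⟨(integrable_indicator_iff hE).1 (h1.congr hmean), ?_⟩
  rw [← integral_indicator hE, ← integral_indicator hE, ← integral_congr_ae hmean, ← hgY,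
    ← integral_map (hτm.prodMk hY).aemeasurable hgm.aestronglyMeasurable,
    ← compProd_map_condDistrib hY.aemeasurable, Measure.integral_compProd hgint',
    integral_map hτm.aemeasurable]
  exact hgm.stronglyMeasurable.integral_condDistrib.aestronglyMeasurable

/-! ### The event `N(t) = n` in terms of the arrival times -/

section ClaimCount

variable {Ω : Type*} [MeasurableSpace Ω] {μ : Measure Ω} {T : ℕ → Ω → ℝ≥0∞}

/-- The arrival sequences with exactly `n` claims up to time `t`. -/
def countSet (t : ℝ) (n : ℕ) : Set (ℕ → ℝ≥0∞) :=
  {s | s 0 = 0 ∧ (∀ k ≤ n, s k ≤ ENNReal.ofReal t) ∧ ENNReal.ofReal t < s (n + 1)}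

theorem measurableSet_countSet (t : ℝ) (n : ℕ) : MeasurableSet (countSet t n) := by
  refine (measurable_pi_apply 0 (measurableSet_singleton 0)).inter (MeasurableSet.inter ?_ ?_)
  · have : MeasurableSet {s : ℕ → ℝ≥0∞ | ∀ k ≤ n, s k ≤ ENNReal.ofReal t} := by
      have : {s : ℕ → ℝ≥0∞ | ∀ k ≤ n, s k ≤ ENNReal.ofReal t}
          = ⋂ k, ⋂ _ : k ≤ n, {s | s k ≤ ENNReal.ofReal t} := by ext; simp
      rw [this]
      exact MeasurableSet.iInter fun k => MeasurableSet.iInter fun _ =>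
        measurable_pi_apply k measurableSet_Iic
    exact this
  · exact measurable_pi_apply (n + 1) measurableSet_Ioi

theorem claimCount_ae_eq_preimage (h : IsArrivalSequence μ T) (t : ℝ) (n : ℕ) :
    ({ω | claimCount T t ω = n} : Set Ω) =ᵐ[μ] (fun ω k => T k ω) ⁻¹' countSet t n := by
  filter_upwards [h.zero, h.strictIncr, h.nonexplosive] with ω h0 h1 h2
  have hmono : Monotone fun k => T k ω := monotone_nat_of_le_succ fun k => by
    rcases h1 k with h | ⟨h, h'⟩
    · exact h.le
    · rw [h, h']
  obtain ⟨N, hN⟩ := h2 t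
  -- Without boundedness `sSup` on ℕ would return the default 0 and `claimCount` would lose its
  -- meaning; this is where nonexplosion enters.
  have hbdd : BddAbove {n : ℕ | T n ω ≤ ENNReal.ofReal t} :=
    ⟨N, fun k hk => not_lt.1 fun hlt => absurd (hN.trans_le (hmono hlt.le)) (not_lt.2 hk)⟩
  have hne : {n : ℕ | T n ω ≤ ENNReal.ofReal t}.Nonempty := ⟨0, by simp [h0]⟩
  refine propext ⟨fun hn => ?_, fun hn => ?_⟩
  · have hn' : sSup {n : ℕ | T n ω ≤ ENNReal.ofReal t} = n := hn
    have hmem := Nat.sSup_mem hne hbdd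
    rw [hn'] at hmem
    refine ⟨h0, fun k hk => (hmono hk).trans hmem, not_le.1 fun hle => ?_⟩
    have := le_csSup hbdd (show n + 1 ∈ {n : ℕ | T n ω ≤ ENNReal.ofReal t} from hle)
    omega
  · refine le_antisymm (csSup_le hne fun k hk => ?_) (le_csSup hbdd (hn.2.1 n le_rfl))
    refine not_lt.1 fun hlt => ?_
    exact absurd (hn.2.2.trans_le (hmono hlt)) (not_lt.2 hk)

theorem nullMeasurableSet_claimCount (h : IsArrivalSequence μ T) (t : ℝ) (n : ℕ) :
    NullMeasurableSet {ω | claimCount T t ω = n} μ :=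
  ((measurable_pi_lambda _ h.measurable
    (measurableSet_countSet t n)).nullMeasurableSet).congr (claimCount_ae_eq_preimage h t n).symm

end ClaimCount

/-! ### From expectations on `N(t) = n` to iterated integrals -/

/-- The first `n` arrival times in descending order, followed by zeros. -/
def descTimes {Ω : Type*} (T : ℕ → Ω → ℝ≥0∞) (n : ℕ) (ω : Ω) : ℕ → ℝ :=
  fun m => if m < n then (T (n - m) ω).toReal else 0

theorem descTimes_apply {Ω : Type*} (T : ℕ → Ω → ℝ≥0∞) {n m k : ℕ} (h : m < n) (hk : n - m = k)
    (ω : Ω) : descTimes T n ω m = (T k ω).toReal := hk ▸ if_pos h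

theorem descTimes_eq_padSeq {Ω : Type*} (T : ℕ → Ω → ℝ≥0∞) (n : ℕ) (ω : Ω) :
    descTimes T n ω = padSeq fun i : Fin n => (T ((i.rev : ℕ) + 1) ω).toReal := by
  funext m
  unfold descTimes padSeq
  split_ifs with h
  · have : n - m = n - (m + 1) + 1 := by omega
    simp only [Fin.val_rev, this]
  · rfl

section Terms

variable {Ω : Type*} [MeasurableSpace Ω] {μ : Measure Ω} {T : ℕ → Ω → ℝ≥0∞}
  {F : ℝ → StieltjesFunction ℝ} {t : ℝ} {f : ℝ → ℝ}

theorem setIntegral_claimCount [IsProbabilityMeasure μ] (hOS : IsOSPointProcess μ T F) (ht : 0 < t)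
    (hf : IsDensityOf f (F t)) (r : ℕ) (l : List ℕ) {n : ℕ} (hn : l.sum + l.length + r = n)
    {h : (ℕ → ℝ) → ℝ} (hh : Measurable h)
    (hint : IntegrableOn (fun ω => h (selectSeq l (descTimes T n ω)))
      {ω | claimCount T t ω = n} μ) :
    ∫ ω in {ω | claimCount T t ω = n}, h (selectSeq l (descTimes T n ω)) ∂μ
      = countProb μ T t n * (n ! * gapIntegralReal (F t) f r l t h) := by
  set E := {ω | claimCount T t ω = n} with hE
  have hπ : countProb μ T t n = μ.real E := rfl
  rcases (measureReal_nonneg : 0 ≤ μ.real E).eq_or_lt with h0 | hpos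
  -- The order statistic property says nothing for a null event, but both sides vanish.
  · have : μ E = 0 := by rwa [eq_comm, measureReal_eq_zero_iff] at h0
    rw [Measure.restrict_eq_zero.2 this, hπ, ← h0]
    simp
  have hlaw := hOS.condLaw t ht n hpos
  have hneg := hOS.cdf_of_neg t ht
  have := isFiniteMeasure_stieltjes hneg hf
  set vec : Ω → Fin n → ℝ := fun ω k => (T ((k : ℕ) + 1) ω).toReal with hvec
  have hvm : Measurable vec :=
    measurable_pi_lambda _ fun k => (hOS.arrival.measurable _).ennreal_toReal
  set Φ : (Fin n → ℝ) → ℝ := fun y => h (selectSeq l (padSeq fun i => y i.rev)) with hΦ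
  have hΦm : Measurable Φ := hh.comp ((measurable_selectSeq l).comp (measurable_padSeq.comp
    (measurable_pi_lambda _ fun i => measurable_pi_apply _)))
  have hfun : (fun ω => h (selectSeq l (descTimes T n ω))) = fun ω => Φ (vec ω) := by
    funext ω; rw [descTimes_eq_padSeq]
  have hμE : μ E ≠ 0 := fun h0 => by simp [Measure.real, h0] at hpos
  have hintc : Integrable (fun ω => Φ (vec ω)) (μ[|E]) := by
    rw [← hfun]
    exact hint.smul_measure (ENNReal.inv_ne_top.2 hμE)
  have hintp : Integrable (fun x => Φ (orderStatistics x))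
      (Measure.pi fun _ : Fin n => (F t).measure) := by
    have h1 : Integrable Φ ((μ[|E]).map vec) :=
      (integrable_map_measure hΦm.aestronglyMeasurable hvm.aemeasurable).2 hintc
    rw [hlaw] at h1
    exact h1.comp_measurable measurable_orderStatistics
  have hcond : ∫ ω, Φ (vec ω) ∂(μ[|E]) = (μ.real E)⁻¹ * ∫ ω in E, Φ (vec ω) ∂μ := by
    rw [ProbabilityTheory.cond, integral_smul_measure, ENNReal.toReal_inv, smul_eq_mul]
    rfl
  have hmap : ∫ ω, Φ (vec ω) ∂(μ[|E])
      = ∫ x, Φ (orderStatistics x) ∂Measure.pi fun _ : Fin n => (F t).measure := by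
    rw [← integral_map hvm.aemeasurable hΦm.aestronglyMeasurable, hlaw,
      integral_map measurable_orderStatistics.aemeasurable hΦm.aestronglyMeasurable]
  have hgap := integral_selectSeq_orderStatistics (stieltjes_measure_eq_withDensity hneg hf)
    hf.integrable.aemeasurable hf.nonneg (stieltjes_zero_eq_zero hneg hf) ht.le
    (ae_stieltjes_measure_mem_Ioc hneg (hOS.cdf_of_ge t ht) hf) r l hn hh hintp
  rw [hfun, hπ, ← hgap]
  refine Eq.trans ?_ (congrArg (μ.real E * ·) (hcond.symm.trans hmap))
  field_simp

/-- Combines conditioning with the order statistic property. To apply it, `l` and `r` specify which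
arrivals are kept, counting from the latest, and `v` puts the kept times back into the order of
`idx`. -/
theorem setIntegral_eq_gapIntegralReal [IsProbabilityMeasure μ] (hOS : IsOSPointProcess μ T F)
    (ht : 0 < t) (hf : IsDensityOf f (F t)) {Y : Ω → ℝ} (hY : Measurable Y) {m : ℕ}
    {idx : Fin m → ℕ} (hdep : DependsOnlyVia μ T Y idx) {n : ℕ}
    (hint : IntegrableOn Y {ω | claimCount T t ω = n} μ) (r : ℕ) (l : List ℕ)
    (hn : l.sum + l.length + r = n) (hidx : ∀ k, idx k ≤ n) {v : (ℕ → ℝ) → Fin m → ℝ}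
    (hv : ∀ k, Measurable fun s => v s k)
    (hvT : ∀ ω k, v (selectSeq l (descTimes T n ω)) k = (T (idx k) ω).toReal) :
    ∫ ω in {ω | claimCount T t ω = n}, Y ω ∂μ
      = countProb μ T t n *
          (n ! * gapIntegralReal (F t) f r l t fun s => condMean μ T Y idx (v s)) := by
  have hae := claimCount_ae_eq_preimage hOS.arrival t n
  have hint' := hint.congr_set_ae hae.symm
  obtain ⟨h1, h2⟩ := setIntegral_eq_setIntegral_condMean hOS.arrival.measurable hY hdep
    (measurableSet_countSet t n)
    (fun s hs k => ne_top_of_le_ne_top ENNReal.ofReal_ne_top (hs.2.1 _ (hidx k))) hint'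
  have hfun : (fun ω => condMean μ T Y idx (v (selectSeq l (descTimes T n ω))))
      = fun ω => condMean μ T Y idx fun k => (T (idx k) ω).toReal := by
    funext ω
    congr 1
    funext k
    exact hvT ω k
  rw [← setIntegral_claimCount hOS ht hf r l hn
    (h := fun s => condMean μ T Y idx (v s)) ((measurable_condMean μ T Y idx).comp (measurable_pi_lambda _ hv)),
    setIntegral_congr_set hae, h2, ← setIntegral_congr_set hae]
  · exact congrArg (fun g : Ω → ℝ => ∫ ω in {ω | claimCount T t ω = n}, g ω ∂μ) hfun.symm
  · have h3 := h1.congr_set_ae hae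
    rw [← hfun] at h3
    exact h3

end Terms

/-! ### The six kinds of terms in A and B -/

section MomentTerms

variable {Ω : Type*} [MeasurableSpace Ω] {μ : Measure Ω} [IsProbabilityMeasure μ]
  {T : ℕ → Ω → ℝ≥0∞} {F : ℝ → StieltjesFunction ℝ} {t : ℝ} {f : ℝ → ℝ} {Y : Ω → ℝ} {n i j : ℕ}

theorem setIntegral_first (hOS : IsOSPointProcess μ T F) (ht : 0 < t) (hf : IsDensityOf f (F t))
    (hY : Measurable Y) (hdep : DependsOnlyVia μ T Y ![0, 1]) (hn : 1 ≤ n)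
    (hint : IntegrableOn Y {ω | claimCount T t ω = n} μ) :
    ∫ ω in {ω | claimCount T t ω = n}, Y ω ∂μ = countProb μ T t n * (n * ∫ y in (0 : ℝ)..t,
      condMean μ T Y ![1] ![y] * f y * (1 - F t y) ^ (n - 1)) := by
  have hdep' : DependsOnlyVia μ T Y ![1] := by
    refine hdep.ae_eq_of_refine hOS.arrival.measurable hY (c := fun u => ![0, u 0]) ?_ ?_
    · refine measurable_pi_lambda _ fun k => ?_
      fin_cases k
      · exact measurable_const
      · exact measurable_pi_apply 0
    · filter_upwards [hOS.arrival.zero] with ω h0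
      funext k
      fin_cases k
      · exact h0
      · rfl
  -- Turns the outermost gap weight F(t) - F(y) into 1 - F(y).
  have h1 := hOS.cdf_of_ge t ht t le_rfl
  have hfac : (n ! : ℝ) = n * (n - 1)! := by exact_mod_cast (Nat.mul_factorial_pred (by omega)).symm
  have hne : ((n - 1)! : ℝ) ≠ 0 := by exact_mod_cast (n - 1).factorial_ne_zero
  rw [setIntegral_eq_gapIntegralReal hOS ht hf hY hdep' hint 0 [n - 1] (v := fun s => ![s 0])
    (by simp; omega)]
  · congr 1
    simp only [gapIntegralReal, ← intervalIntegral.integral_const_mul, h1, consSeq]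
    refine intervalIntegral.integral_congr fun y _ => ?_
    simp only [pow_zero, Nat.factorial_zero, Nat.cast_one, hfac]
    field_simp
  · intro k; fin_cases k; simpa using hn
  · intro k; fin_cases k; exact measurable_pi_apply _
  · intro ω k
    fin_cases k
    exact descTimes_apply T (by omega) (by simp; omega) ω

theorem setIntegral_pair (hOS : IsOSPointProcess μ T F) (ht : 0 < t) (hf : IsDensityOf f (F t))
    (hY : Measurable Y) (hi : 2 ≤ i) (hin : i ≤ n) (hdep : DependsOnlyVia μ T Y ![i - 1, i])
    (hint : IntegrableOn Y {ω | claimCount T t ω = n} μ) :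
    ∫ ω in {ω | claimCount T t ω = n}, Y ω ∂μ = countProb μ T t n *
      ((n ! : ℝ) / (((i - 2)! : ℝ) * ((n - i)! : ℝ)) * ∫ y in (0 : ℝ)..t, ∫ x in (0 : ℝ)..y,
        condMean μ T Y ![i - 1, i] ![x, y]
          * f x * f y * F t x ^ (i - 2) * (1 - F t y) ^ (n - i)) := by
  have h1 := hOS.cdf_of_ge t ht t le_rfl
  -- There are n-i arrivals after T_i, none between T_{i-1} and T_i, and i-2 before T_{i-1}.
  rw [setIntegral_eq_gapIntegralReal hOS ht hf hY hdep hint (i - 2) [n - i, 0]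
    (v := fun s => ![s 1, s 0]) (by simp; omega)]
  · congr 1
    simp only [gapIntegralReal, ← intervalIntegral.integral_const_mul, h1, consSeq]
    refine intervalIntegral.integral_congr fun y _ => intervalIntegral.integral_congr fun x _ => ?_
    simp only [pow_zero, Nat.factorial_zero, Nat.cast_one]
    ring
  · intro k; fin_cases k <;> simp <;> omega
  · intro k; fin_cases k <;> exact measurable_pi_apply _
  · intro ω k
    fin_cases k
    · exact descTimes_apply T (by omega) (by simp; omega) ω
    · exact descTimes_apply T (by omega) (by simp; omega) ω

theorem setIntegral_first_second (hOS : IsOSPointProcess μ T F) (ht : 0 < t)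
    (hf : IsDensityOf f (F t)) (hY : Measurable Y) (hdep : DependsOnlyVia μ T Y ![0, 1, 1, 2])
    (hn : 2 ≤ n) (hint : IntegrableOn Y {ω | claimCount T t ω = n} μ) :
    ∫ ω in {ω | claimCount T t ω = n}, Y ω ∂μ = countProb μ T t n *
      ((n : ℝ) * ((n : ℝ) - 1) * ∫ z in (0 : ℝ)..t, ∫ y in (0 : ℝ)..z,
        condMean μ T Y ![1, 2] ![y, z] * f y * f z * (1 - F t z) ^ (n - 2)) := by
  have hdep' : DependsOnlyVia μ T Y ![1, 2] := by
    refine hdep.ae_eq_of_refine hOS.arrival.measurable hY (c := fun u => ![0, u 0, u 0, u 1]) ?_ ?_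
    · refine measurable_pi_lambda _ fun k => ?_
      fin_cases k
      · exact measurable_const
      all_goals exact measurable_pi_apply _
    · filter_upwards [hOS.arrival.zero] with ω h0
      funext k
      fin_cases k
      · exact h0
      all_goals rfl
  have h1 := hOS.cdf_of_ge t ht t le_rfl
  have hfac : (n ! : ℝ) = n * (n - 1) * (n - 2)! := by
    obtain ⟨m, rfl⟩ := Nat.exists_eq_add_of_le' hn
    simp only [Nat.factorial_succ, Nat.add_sub_cancel]
    push_cast
    ring
  have hne : ((n - 2)! : ℝ) ≠ 0 := by exact_mod_cast (n - 2).factorial_ne_zero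
  rw [setIntegral_eq_gapIntegralReal hOS ht hf hY hdep' hint 0 [n - 2, 0]
    (v := fun s => ![s 1, s 0]) (by simp; omega)]
  · congr 1
    simp only [gapIntegralReal, ← intervalIntegral.integral_const_mul, h1, consSeq]
    refine intervalIntegral.integral_congr fun z _ => intervalIntegral.integral_congr fun y _ => ?_
    simp only [pow_zero, Nat.factorial_zero, Nat.cast_one, hfac]
    field_simp
  · intro k; fin_cases k <;> simp <;> omega
  · intro k; fin_cases k <;> exact measurable_pi_apply _
  · intro ω k
    fin_cases k
    · exact descTimes_apply T (by omega) (by simp; omega) ω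
    · exact descTimes_apply T (by omega) (by simp; omega) ω

theorem setIntegral_first_later (hOS : IsOSPointProcess μ T F) (ht : 0 < t)
    (hf : IsDensityOf f (F t)) (hY : Measurable Y) (hj : 3 ≤ j) (hjn : j ≤ n)
    (hdep : DependsOnlyVia μ T Y ![0, 1, j - 1, j])
    (hint : IntegrableOn Y {ω | claimCount T t ω = n} μ) :
    ∫ ω in {ω | claimCount T t ω = n}, Y ω ∂μ = countProb μ T t n *
      ((n ! : ℝ) / (((j - 3)! : ℝ) * ((n - j)! : ℝ)) *
        ∫ z in (0 : ℝ)..t, ∫ w in (0 : ℝ)..z, ∫ y in (0 : ℝ)..w,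
          condMean μ T Y ![1, j - 1, j] ![y, w, z]
            * f y * f w * f z * (F t w - F t y) ^ (j - 3) * (1 - F t z) ^ (n - j)) := by
  have hdep' : DependsOnlyVia μ T Y ![1, j - 1, j] := by
    refine hdep.ae_eq_of_refine hOS.arrival.measurable hY
      (c := fun u => ![0, u 0, u 1, u 2]) ?_ ?_
    · refine measurable_pi_lambda _ fun k => ?_
      fin_cases k
      · exact measurable_const
      all_goals exact measurable_pi_apply _
    · filter_upwards [hOS.arrival.zero] with ω h0
      funext k
      fin_cases k
      · exact h0
      all_goals rfl
  have h1 := hOS.cdf_of_ge t ht t le_rfl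
  -- The j-3 arrivals strictly between T_1 and T_{j-1} produce the factor (F(w) - F(y))^(j-3); none
  -- lie below T_1.
  rw [setIntegral_eq_gapIntegralReal hOS ht hf hY hdep' hint 0 [n - j, 0, j - 3]
    (v := fun s => ![s 2, s 1, s 0]) (by simp; omega)]
  · congr 1
    simp only [gapIntegralReal, ← intervalIntegral.integral_const_mul, h1, consSeq]
    refine intervalIntegral.integral_congr fun z _ => intervalIntegral.integral_congr fun w _ =>
      intervalIntegral.integral_congr fun y _ => ?_
    simp only [pow_zero, Nat.factorial_zero, Nat.cast_one]
    ring
  · intro k; fin_cases k <;> simp <;> omega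
  · intro k; fin_cases k <;> exact measurable_pi_apply _
  · intro ω k
    fin_cases k
    · exact descTimes_apply T (by omega) (by simp; omega) ω
    · exact descTimes_apply T (by omega) (by simp; omega) ω
    · exact descTimes_apply T (by omega) (by simp; omega) ω

theorem setIntegral_consecutive (hOS : IsOSPointProcess μ T F) (ht : 0 < t)
    (hf : IsDensityOf f (F t)) (hY : Measurable Y) (hi : 2 ≤ i) (hin : i + 1 ≤ n)
    (hdep : DependsOnlyVia μ T Y ![i - 1, i, i, i + 1])
    (hint : IntegrableOn Y {ω | claimCount T t ω = n} μ) :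
    ∫ ω in {ω | claimCount T t ω = n}, Y ω ∂μ = countProb μ T t n *
      ((n ! : ℝ) / (((i - 2)! : ℝ) * ((n - i - 1)! : ℝ)) *
        ∫ z in (0 : ℝ)..t, ∫ w in (0 : ℝ)..z, ∫ y in (0 : ℝ)..w,
          condMean μ T Y ![i - 1, i, i + 1] ![y, w, z]
            * f y * f w * f z * F t y ^ (i - 2) * (1 - F t z) ^ (n - i - 1)) := by
  have hdep' : DependsOnlyVia μ T Y ![i - 1, i, i + 1] := by
    refine hdep.ae_eq_of_refine hOS.arrival.measurable hY
      (c := fun u => ![u 0, u 1, u 1, u 2]) ?_ (Filter.Eventually.of_forall fun ω => ?_)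
    · refine measurable_pi_lambda _ fun k => ?_
      fin_cases k <;> exact measurable_pi_apply _
    · funext k
      fin_cases k <;> rfl
  have h1 := hOS.cdf_of_ge t ht t le_rfl
  rw [setIntegral_eq_gapIntegralReal hOS ht hf hY hdep' hint (i - 2) [n - i - 1, 0, 0]
    (v := fun s => ![s 2, s 1, s 0]) (by simp; omega)]
  · congr 1
    simp only [gapIntegralReal, ← intervalIntegral.integral_const_mul, h1, consSeq]
    refine intervalIntegral.integral_congr fun z _ => intervalIntegral.integral_congr fun w _ =>
      intervalIntegral.integral_congr fun y _ => ?_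
    simp only [pow_zero, Nat.factorial_zero, Nat.cast_one]
    ring
  · intro k; fin_cases k <;> simp <;> omega
  · intro k; fin_cases k <;> exact measurable_pi_apply _
  · intro ω k
    fin_cases k
    · exact descTimes_apply T (by omega) (by simp; omega) ω
    · exact descTimes_apply T (by omega) (by simp; omega) ω
    · exact descTimes_apply T (by omega) (by simp; omega) ω

theorem setIntegral_separated (hOS : IsOSPointProcess μ T F) (ht : 0 < t)
    (hf : IsDensityOf f (F t)) (hY : Measurable Y) (hi : 2 ≤ i) (hij : i + 2 ≤ j) (hjn : j ≤ n)
    (hdep : DependsOnlyVia μ T Y ![i - 1, i, j - 1, j])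
    (hint : IntegrableOn Y {ω | claimCount T t ω = n} μ) :
    ∫ ω in {ω | claimCount T t ω = n}, Y ω ∂μ = countProb μ T t n *
      ((n ! : ℝ) / (((i - 2)! : ℝ) * ((j - i - 2)! : ℝ) * ((n - j)! : ℝ)) *
        ∫ z in (0 : ℝ)..t, ∫ w in (0 : ℝ)..z, ∫ y in (0 : ℝ)..w, ∫ x in (0 : ℝ)..y,
          condMean μ T Y ![i - 1, i, j - 1, j] ![x, y, w, z]
            * f x * f y * f w * f z
            * F t x ^ (i - 2) * (F t w - F t y) ^ (j - i - 2) * (1 - F t z) ^ (n - j)) := by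
  have h1 := hOS.cdf_of_ge t ht t le_rfl
  -- Four distinct times: the only gaps are above T_j, between T_i and T_{j-1}, and below T_{i-1}.
  rw [setIntegral_eq_gapIntegralReal hOS ht hf hY hdep hint (i - 2) [n - j, 0, j - i - 2, 0]
    (v := fun s => ![s 3, s 2, s 1, s 0]) (by simp; omega)]
  · congr 1
    simp only [gapIntegralReal, ← intervalIntegral.integral_const_mul, h1, consSeq]
    refine intervalIntegral.integral_congr fun z _ => intervalIntegral.integral_congr fun w _ =>
      intervalIntegral.integral_congr fun y _ => intervalIntegral.integral_congr fun x _ => ?_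
    simp only [pow_zero, Nat.factorial_zero, Nat.cast_one]
    ring
  · intro k; fin_cases k <;> simp <;> omega
  · intro k; fin_cases k <;> exact measurable_pi_apply _
  · intro ω k
    fin_cases k
    · exact descTimes_apply T (by omega) (by simp; omega) ω
    · exact descTimes_apply T (by omega) (by simp; omega) ω
    · exact descTimes_apply T (by omega) (by simp; omega) ω
    · exact descTimes_apply T (by omega) (by simp; omega) ω

end MomentTerms

/-! ### Expanding the square and collecting terms -/

theorem sum_Icc_eq_add_sum_Icc_succ (g : ℕ → ℝ) {a b : ℕ} (hab : a ≤ b) :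
    ∑ i ∈ Finset.Icc a b, g i = g a + ∑ i ∈ Finset.Icc (a + 1) b, g i := by
  rw [← Finset.insert_Icc_add_one_left_eq_Icc hab, Finset.sum_insert (by simp)]

theorem sq_sum_Icc (x : ℕ → ℝ) (n : ℕ) :
    (∑ i ∈ Finset.Icc 1 n, x i) ^ 2 = ∑ i ∈ Finset.Icc 1 n, x i ^ 2
      + 2 * ∑ i ∈ Finset.Icc 1 n, ∑ j ∈ Finset.Icc (i + 1) n, x i * x j := by
  induction n with
  | zero => simp
  | succ n ih =>
    have h1 : ∑ i ∈ Finset.Icc 1 n, ∑ j ∈ Finset.Icc (i + 1) (n + 1), x i * x j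
        = ∑ i ∈ Finset.Icc 1 n, (∑ j ∈ Finset.Icc (i + 1) n, x i * x j + x i * x (n + 1)) := by
      refine Finset.sum_congr rfl fun i hi => ?_
      rw [Finset.sum_Icc_succ_top (by simp at hi; omega)]
    rw [Finset.sum_Icc_succ_top (by omega), Finset.sum_Icc_succ_top (by omega),
      Finset.sum_Icc_succ_top (by omega), h1, Finset.sum_add_distrib, ← Finset.sum_mul, add_sq, ih,
      Finset.Icc_eq_empty (by omega : ¬ n + 1 + 1 ≤ n + 1), Finset.sum_empty]
    ring

/-- The pairs are sorted by whether i = 1 and whether j = i+1, since each coincidence removes one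
conditioning time and changes the integral. -/
theorem sum_pairs_eq (I : ℕ → ℕ → ℝ) {n : ℕ} (hn : 2 ≤ n) :
    ∑ i ∈ Finset.Icc 1 n, ∑ j ∈ Finset.Icc (i + 1) n, I i j
      = I 1 2 + ∑ j ∈ Finset.Icc 3 n, I 1 j + ∑ i ∈ Finset.Icc 2 (n - 1), I i (i + 1)
        + ∑ i ∈ Finset.Icc 2 (n - 2), ∑ j ∈ Finset.Icc (i + 2) n, I i j := by
  obtain ⟨m, rfl⟩ := Nat.exists_eq_add_of_le' hn
  have h1 : ∑ i ∈ Finset.Icc 2 (m + 1), ∑ j ∈ Finset.Icc (i + 1) (m + 2), I i j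
      = ∑ i ∈ Finset.Icc 2 (m + 1), (I i (i + 1) + ∑ j ∈ Finset.Icc (i + 2) (m + 2), I i j) := by
    refine Finset.sum_congr rfl fun i hi => ?_
    exact sum_Icc_eq_add_sum_Icc_succ _ (by simp at hi; omega)
  -- For i = n-1 no j is at least i+2, so the outer range may stop at n-2.
  have h2 : ∑ i ∈ Finset.Icc 2 (m + 1), ∑ j ∈ Finset.Icc (i + 2) (m + 2), I i j
      = ∑ i ∈ Finset.Icc 2 m, ∑ j ∈ Finset.Icc (i + 2) (m + 2), I i j := by
    refine (Finset.sum_subset (Finset.Icc_subset_Icc_right (by omega)) fun i hi hi' => ?_).symm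
    simp only [Finset.mem_Icc] at hi hi'
    rw [Finset.Icc_eq_empty (by omega), Finset.sum_empty]
  have h3 : ∑ i ∈ Finset.Icc 2 (m + 2), ∑ j ∈ Finset.Icc (i + 1) (m + 2), I i j
      = ∑ i ∈ Finset.Icc 2 (m + 1), ∑ j ∈ Finset.Icc (i + 1) (m + 2), I i j := by
    rw [Finset.sum_Icc_succ_top (by omega), Finset.Icc_eq_empty (by omega : ¬ m + 1 + 1 + 1 ≤ m + 2),
      Finset.sum_empty, add_zero]
  rw [sum_Icc_eq_add_sum_Icc_succ _ (by omega), sum_Icc_eq_add_sum_Icc_succ _ (by omega), h3, h1,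
    Finset.sum_add_distrib, h2, Nat.add_sub_cancel, (by omega : m + 2 - 1 = m + 1)]
  ring

section SecondMoment

variable {Ω : Type*} [MeasurableSpace Ω] {μ : Measure Ω} [IsProbabilityMeasure μ]
  {T : ℕ → Ω → ℝ≥0∞} {X : ℕ → Ω → ℝ} {F : ℝ → StieltjesFunction ℝ} {t : ℝ} {f : ℝ → ℝ} {n : ℕ}

theorem sum_setIntegral_sq_eq_momentA (hOS : IsOSPointProcess μ T F)
    (hX : ∀ i, 1 ≤ i → Measurable (X i)) (hdep : ∀ i, 1 ≤ i → DependsOnlyVia μ T (X i) ![i - 1, i])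
    (ht : 0 < t) (hf : IsDensityOf f (F t))
    (hint : ∀ i, 1 ≤ i → i ≤ n → IntegrableOn (fun ω => X i ω ^ 2) {ω | claimCount T t ω = n} μ)
    (hn : 1 ≤ n) :
    ∑ i ∈ Finset.Icc 1 n, ∫ ω in {ω | claimCount T t ω = n}, X i ω ^ 2 ∂μ
      = countProb μ T t n * momentA μ T X (F t) f t n := by
  have hdep' : ∀ i, 1 ≤ i → DependsOnlyVia μ T (fun ω => X i ω ^ 2) ![i - 1, i] := fun i hi =>
    (hdep i hi).comp hOS.arrival.measurable (hX i hi) (g := fun x => x ^ 2)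
      (measurable_id'.pow_const 2)
  rw [sum_Icc_eq_add_sum_Icc_succ _ hn, momentA, mul_add, Finset.mul_sum,
    setIntegral_first hOS ht hf ((hX 1 le_rfl).pow_const 2) (hdep' 1 le_rfl) hn (hint 1 le_rfl hn)]
  congr 1
  refine Finset.sum_congr rfl fun i hi => ?_
  obtain ⟨hi2, hin⟩ := Finset.mem_Icc.1 hi
  exact setIntegral_pair hOS ht hf ((hX i (by omega)).pow_const 2) hi2 hin (hdep' i (by omega))
    (hint i (by omega) hin)

theorem sum_setIntegral_mul_eq_momentB (hOS : IsOSPointProcess μ T F)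
    (hX : ∀ i, 1 ≤ i → Measurable (X i))
    (hdep : ∀ i j, 1 ≤ i → i < j →
      DependsOnlyVia μ T (fun ω => X i ω * X j ω) ![i - 1, i, j - 1, j])
    (ht : 0 < t) (hf : IsDensityOf f (F t))
    (hint : ∀ i j, 1 ≤ i → i ≤ n → 1 ≤ j → j ≤ n →
      IntegrableOn (fun ω => X i ω * X j ω) {ω | claimCount T t ω = n} μ)
    (hn : 1 ≤ n) :
    ∑ i ∈ Finset.Icc 1 n, ∑ j ∈ Finset.Icc (i + 1) n,
        ∫ ω in {ω | claimCount T t ω = n}, X i ω * X j ω ∂μ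
      = countProb μ T t n * momentB μ T X (F t) f t n := by
  rcases hn.eq_or_lt with rfl | hn
  · simp [momentB]
  have hm : ∀ i j, 1 ≤ i → 1 ≤ j → Measurable fun ω => X i ω * X j ω :=
    fun i j hi hj => (hX i hi).mul (hX j hj)
  rw [sum_pairs_eq (fun i j => ∫ ω in {ω | claimCount T t ω = n}, X i ω * X j ω ∂μ) hn, momentB]
  simp only [mul_add, Finset.mul_sum]
  refine congrArg₂ (· + ·) (congrArg₂ (· + ·) (congrArg₂ (· + ·) ?_ ?_) ?_) ?_
  · exact setIntegral_first_second hOS ht hf (hm 1 2 (by omega) (by omega))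
      (hdep 1 2 (by omega) (by omega)) hn (hint 1 2 (by omega) (by omega) (by omega) hn)
  · refine Finset.sum_congr rfl fun j hj => ?_
    obtain ⟨hj3, hjn⟩ := Finset.mem_Icc.1 hj
    exact setIntegral_first_later hOS ht hf (hm 1 j (by omega) (by omega)) hj3 hjn
      (hdep 1 j (by omega) (by omega)) (hint 1 j (by omega) (by omega) (by omega) hjn)
  · refine Finset.sum_congr rfl fun i hi => ?_
    obtain ⟨hi2, hin⟩ := Finset.mem_Icc.1 hi
    exact setIntegral_consecutive hOS ht hf (hm i (i + 1) (by omega) (by omega)) hi2 (by omega)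
      (hdep i (i + 1) (by omega) (by omega))
      (hint i (i + 1) (by omega) (by omega) (by omega) (by omega))
  · refine Finset.sum_congr rfl fun i hi => Finset.sum_congr rfl fun j hj => ?_
    obtain ⟨hi2, hin⟩ := Finset.mem_Icc.1 hi
    obtain ⟨hij, hjn⟩ := Finset.mem_Icc.1 hj
    exact setIntegral_separated hOS ht hf (hm i j (by omega) (by omega)) hi2 hij hjn
      (hdep i j (by omega) (by omega)) (hint i j (by omega) (by omega) (by omega) hjn)

theorem setIntegral_sq_sum_eq (hOS : IsOSPointProcess μ T F)
    (hX : ∀ i, 1 ≤ i → Measurable (X i)) (hdep : ∀ i, 1 ≤ i → DependsOnlyVia μ T (X i) ![i - 1, i])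
    (hdep2 : ∀ i j, 1 ≤ i → i < j →
      DependsOnlyVia μ T (fun ω => X i ω * X j ω) ![i - 1, i, j - 1, j])
    (ht : 0 < t) (hf : IsDensityOf f (F t))
    (hint : ∀ i, 1 ≤ i → i ≤ n → IntegrableOn (fun ω => X i ω ^ 2) {ω | claimCount T t ω = n} μ)
    (hn : 1 ≤ n) :
    IntegrableOn (fun ω => (∑ i ∈ Finset.Icc 1 n, X i ω) ^ 2) {ω | claimCount T t ω = n} μ ∧
      ∫ ω in {ω | claimCount T t ω = n}, (∑ i ∈ Finset.Icc 1 n, X i ω) ^ 2 ∂μ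
        = countProb μ T t n *
          (momentA μ T X (F t) f t n + 2 * momentB μ T X (F t) f t n) := by
  -- By Cauchy–Schwarz, second moments on the event control the mixed products, so the expansion can
  -- be integrated termwise.
  have hint2 : ∀ i j, 1 ≤ i → i ≤ n → 1 ≤ j → j ≤ n →
      IntegrableOn (fun ω => X i ω * X j ω) {ω | claimCount T t ω = n} μ :=
    fun i j hi hin hj hjn => MemLp.integrable_mul (p := 2) (q := 2)
      ((memLp_two_iff_integrable_sq (hX i hi).aestronglyMeasurable).2 (hint i hi hin))
      ((memLp_two_iff_integrable_sq (hX j hj).aestronglyMeasurable).2 (hint j hj hjn))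
  have hi1 : Integrable (fun ω => ∑ i ∈ Finset.Icc 1 n, X i ω ^ 2)
      (μ.restrict {ω | claimCount T t ω = n}) :=
    integrable_finsetSum _ fun i hi => hint i (Finset.mem_Icc.1 hi).1 (Finset.mem_Icc.1 hi).2
  have hi3 : ∀ i ∈ Finset.Icc 1 n, ∀ j ∈ Finset.Icc (i + 1) n,
      Integrable (fun ω => X i ω * X j ω) (μ.restrict {ω | claimCount T t ω = n}) :=
    fun i hi j hj => by
      rw [Finset.mem_Icc] at hi hj
      exact hint2 i j hi.1 hi.2 (by omega) hj.2
  have hi4 : ∀ i ∈ Finset.Icc 1 n, Integrable (fun ω => ∑ j ∈ Finset.Icc (i + 1) n, X i ω * X j ω)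
      (μ.restrict {ω | claimCount T t ω = n}) := fun i hi => integrable_finsetSum _ (hi3 i hi)
  have hi2 : Integrable
      (fun ω => 2 * ∑ i ∈ Finset.Icc 1 n, ∑ j ∈ Finset.Icc (i + 1) n, X i ω * X j ω)
      (μ.restrict {ω | claimCount T t ω = n}) := (integrable_finsetSum _ hi4).const_mul 2
  have hsq : ∀ ω, (∑ i ∈ Finset.Icc 1 n, X i ω) ^ 2 = ∑ i ∈ Finset.Icc 1 n, X i ω ^ 2
      + 2 * ∑ i ∈ Finset.Icc 1 n, ∑ j ∈ Finset.Icc (i + 1) n, X i ω * X j ω :=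
    fun ω => sq_sum_Icc (fun i => X i ω) n
  simp only [hsq]
  refine ⟨hi1.add hi2, ?_⟩
  rw [integral_add hi1 hi2, integral_const_mul, integral_finsetSum _ fun i hi =>
    hint i (Finset.mem_Icc.1 hi).1 (Finset.mem_Icc.1 hi).2, integral_finsetSum _ hi4,
    Finset.sum_congr rfl fun i hi => integral_finsetSum _ (hi3 i hi),
    sum_setIntegral_sq_eq_momentA hOS hX hdep ht hf hint hn,
    sum_setIntegral_mul_eq_momentB hOS hX hdep2 ht hf hint2 hn]
  ring

end SecondMoment

end

/-! ### Summation over the number of claims -/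

theorem mainTheorem2 {Ω : Type*} [MeasurableSpace Ω] (μ : Measure Ω) [IsProbabilityMeasure μ]
    (T : ℕ → Ω → ℝ≥0∞) (X : ℕ → Ω → ℝ) (F : ℝ → StieltjesFunction ℝ)
    (hOS : IsOSPointProcess μ T F)
    (hX : ∀ i, 1 ≤ i → Measurable (X i))
    (hdep : ∀ i, 1 ≤ i → DependsOnlyVia μ T (X i) ![i - 1, i])
    (hdep2 : ∀ i j, 1 ≤ i → i < j →
      DependsOnlyVia μ T (fun ω => X i ω * X j ω) ![i - 1, i, j - 1, j])
    (t : ℝ) (ht : 0 < t) (f : ℝ → ℝ) (hf : IsDensityOf f (F t))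
    (hmom : ∀ n i, 1 ≤ i → i ≤ n →
      IntegrableOn (fun ω => X i ω ^ 2) {ω | claimCount T t ω = n} μ) :
    (∀ n, 1 ≤ n →
      0 ≤ countProb μ T t n * (momentA μ T X (F t) f t n + 2 * momentB μ T X (F t) f t n)) ∧
    ∫⁻ ω, ENNReal.ofReal (aggregateClaim T X t ω ^ 2) ∂μ
      = ∑' n : ℕ, ENNReal.ofReal (countProb μ T t (n + 1) *
          (momentA μ T X (F t) f t (n + 1) + 2 * momentB μ T X (F t) f t (n + 1))) := by
  have hmain := fun n hn => setIntegral_sq_sum_eq (n := n) hOS hX hdep hdep2 ht hf (hmom n) hn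
  -- The arrival properties hold only almost surely, so null measurability of the events is what is
  -- available.
  have hE := nullMeasurableSet_claimCount hOS.arrival t
  have hdisj : Pairwise (Function.onFun (AEDisjoint μ) fun n => {ω | claimCount T t ω = n}) :=
    fun m n hmn => Disjoint.aedisjoint (disjoint_left.2 fun ω h1 h2 => hmn (h1.symm.trans h2))
  have hunion : ⋃ n, {ω | claimCount T t ω = n} = univ :=
    eq_univ_of_forall fun ω => mem_iUnion.2 ⟨_, rfl⟩
  have hcongr : ∀ n, ∫⁻ ω in {ω | claimCount T t ω = n},
      ENNReal.ofReal (aggregateClaim T X t ω ^ 2) ∂μ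
      = ∫⁻ ω in {ω | claimCount T t ω = n},
        ENNReal.ofReal ((∑ i ∈ Finset.Icc 1 n, X i ω) ^ 2) ∂μ := fun n => by
    refine lintegral_congr_ae ((ae_restrict_iff'₀ (hE n)).2 (Filter.Eventually.of_forall ?_))
    intro ω hω
    have hω' : claimCount T t ω = n := hω
    simp only [aggregateClaim, hω']
  refine ⟨fun n hn => ?_, ?_⟩
  -- Each term is the integral of a square, although B alone may be negative.
  · rw [← (hmain n hn).2]
    exact integral_nonneg fun ω => sq_nonneg _
  · have hsplit : ∫⁻ ω, ENNReal.ofReal (aggregateClaim T X t ω ^ 2) ∂μ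
        = ∑' n, ∫⁻ ω in {ω | claimCount T t ω = n},
            ENNReal.ofReal ((∑ i ∈ Finset.Icc 1 n, X i ω) ^ 2) ∂μ := by
      rw [← tsum_congr hcongr, ← lintegral_iUnion₀ hE hdisj, hunion, setLIntegral_univ]
    have hzero : ∫⁻ ω in {ω | claimCount T t ω = 0},
        ENNReal.ofReal ((∑ i ∈ Finset.Icc 1 0, X i ω) ^ 2) ∂μ = 0 := by simp
    -- On `N(t) = 0` the aggregate claim is an empty sum, so the series starts at n = 1.
    rw [hsplit, tsum_eq_zero_add' ENNReal.summable, hzero, zero_add]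
    refine tsum_congr fun n => ?_
    have h := hmain (n + 1) (Nat.succ_pos n)
    rw [← h.2]
    exact (ofReal_integral_eq_lintegral_ofReal h.1
      (Filter.Eventually.of_forall fun ω => sq_nonneg _)).symm
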